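/- A decision problem is *decided in time $O(f)$* if there are a (deterministic) word-RAM program and a constant $c$ such that, on inputs of $N$ words and with any word size of at least $c\log_2(N+2)$ bits, the program decides every instance of size $n$ correctly within $O(f(n))$ steps. *Orthogonal Vectors Conjecture (OVC).* Given $n\ge 1$ vectors $a_1,\dots,a_n$ and $n$ vectors $b_1,\dots,b_n$ in $\{0,1\}^d$, where $d=d(n)$, decide whether $\sum_k a_{i,k}b_{j,k}=0$ for some $i,j$. OVC states that for every $d(n)=\omega(\log n)$ and every $\varepsilon>0$ this problem cannot be decided in time $O(n^{2-\varepsilon})$. *Barking distance.* For polylines $P,Q$ in the Euclidean plane, of lengths $|P|,|Q|$ and parametrized by arc length as $P[\cdot],Q[\cdot]$, a barking radius $\rho$ and a maximum speed $s$ of the dog (the hiker has speed $1$), let $$\mathcal D^s_\rho(P,Q)=\inf_\gamma \lambda\big(\{t\in[0,|P|] : \|P[t]-Q[\gamma(t)]\|>\rho\}\big),$$ where $\lambda$ is Lebesgue measure and $\gamma$ ranges over the $s$-Lipschitz (not necessarily monotone) functions $\gamma:[0,|P|]\to[0,|Q|]$ with $\gamma(0)=0$ and $\gamma(|P|)=|Q|$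 (the infimum is $\infty$ if there is none). **Theorem.** Assume OVC. Then for every constant $\rho>0$ there is a constant $\kappa$ such that for every $\varepsilon>0$ the following problem cannot be decided in time $O(n^{2-\varepsilon})$: given two disjoint simple polylines $P$ and $Q$ in the plane with $n\ge 2$ vertices each, whose coordinates are rationals (given as fractions) with numerators and denominators at most $n^{\kappa}$ in absolute value, decide whether $\mathcal D^1_\rho(P,Q)=0$; that is, whether the barking distance with radius $\rho$ is zero when the maximum speed of the dog equals the speed of the hiker. -/

import Mathlib

open scoped ENNReal NNReal

/-! ### The word RAM

Words are natural numbers below `2 ^ w`. A program uses finitely many registers and finitely many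
word-indexed arrays, and every elementary instruction and every test takes one time step. -/

namespace WordRAM

/-- The unit-cost operations on words. -/
inductive BinOp where
  | add | sub | mul | div | mod | and | or | xor | shl | shr | eq | lt

/-- Semantics of the operations on `w`-bit words (arithmetic is modulo `2 ^ w`). -/
def BinOp.eval (w : ℕ) : BinOp → ℕ → ℕ → ℕ
  | .add, a, b => (a + b) % 2 ^ w
  | .sub, a, b => (a + (2 ^ w - b % 2 ^ w)) % 2 ^ w
  | .mul, a, b => (a * b) % 2 ^ w
  | .div, a, b => a / b
  | .mod, a, b => a % b
  | .and, a, b => a &&& b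
  | .or, a, b => a ||| b
  | .xor, a, b => a ^^^ b
  | .shl, a, b => (a * 2 ^ b) % 2 ^ w
  | .shr, a, b => a / 2 ^ b
  | .eq, a, b => if a = b then 1 else 0
  | .lt, a, b => if a < b then 1 else 0

/-- Programs. Registers and arrays are named by numerals that are fixed in the program text;
positions inside an array are computed at run time. -/
inductive Prog where
  /-- register `r` := the constant `k` -/
  | const (r k : ℕ)
  /-- register `r` := `o` applied to registers `a` and `b` -/
  | op (o : BinOp) (r a b : ℕ)
  /-- register `r` := the entry of array `m` at the position in register `a` -/
  | load (r m a : ℕ)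
  /-- the entry of array `m` at the position in register `a` := register `b` -/
  | store (m a b : ℕ)
  /-- `p`, then `q` -/
  | seq (p q : Prog)
  /-- if register `a` is nonzero then `p` else `q` -/
  | branch (a : ℕ) (p q : Prog)
  /-- while register `a` is nonzero do `p` -/
  | loop (a : ℕ) (p : Prog)

/-- Contents of the registers and of the arrays. -/
structure State where
  reg : ℕ → ℕ
  mem : ℕ → ℕ → ℕ

/-- Write the value `v` to register `r`. -/
def State.setReg (s : State) (r v : ℕ) : State :=
  { s with reg := Function.update s.reg r v }

/-- Write the value `v` to position `i` of array `m`. -/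
def State.setMem (s : State) (m i v : ℕ) : State :=
  { s with mem := Function.update s.mem m (Function.update (s.mem m) i v) }

/-- `Run w p s t s'`: with word size `w`, the program `p` started in state `s` halts in state `s'`
after exactly `t` time steps. -/
inductive Run (w : ℕ) : Prog → State → ℕ → State → Prop
  | const (r k : ℕ) (s : State) : Run w (.const r k) s 1 (s.setReg r (k % 2 ^ w))
  | op (o : BinOp) (r a b : ℕ) (s : State) :
      Run w (.op o r a b) s 1 (s.setReg r (o.eval w (s.reg a) (s.reg b)))
  | load (r m a : ℕ) (s : State) :
      Run w (.load r m a) s 1 (s.setReg r (s.mem m (s.reg a)))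
  | store (m a b : ℕ) (s : State) :
      Run w (.store m a b) s 1 (s.setMem m (s.reg a) (s.reg b))
  | seq {p q : Prog} {s s' s'' : State} {t t' : ℕ} :
      Run w p s t s' → Run w q s' t' s'' → Run w (.seq p q) s (t + t') s''
  | branch_true {a : ℕ} {p q : Prog} {s s' : State} {t : ℕ} :
      s.reg a ≠ 0 → Run w p s t s' → Run w (.branch a p q) s (t + 1) s'
  | branch_false {a : ℕ} {p q : Prog} {s s' : State} {t : ℕ} :
      s.reg a = 0 → Run w q s t s' → Run w (.branch a p q) s (t + 1) s'
  | loop_done {a : ℕ} {p : Prog} {s : State} : s.reg a = 0 → Run w (.loop a p) s 1 s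
  | loop_step {a : ℕ} {p : Prog} {s s' s'' : State} {t t' : ℕ} :
      s.reg a ≠ 0 → Run w p s t s' → Run w (.loop a p) s' t' s'' →
      Run w (.loop a p) s (t + t' + 1) s''

/-- The initial state on input `x`: array `0` starts with `x`, everything else is zero. -/
def init (x : List ℕ) : State where
  reg := fun _ => 0
  mem := fun m i => if m = 0 then x.getD i 0 else 0

end WordRAM

/-- A decision problem: its instances, the size parameter in which running times are measured, the
list of words by which an instance is given to a machine, and the set of yes-instances. -/
structure DecisionProblem where
  Inst : Type
  size : Inst → ℕ
  words : Inst → List ℕ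
  Yes : Inst → Prop

/-- The problem `Pb` is decided in time `O(f(size))` on the word RAM with words of `O(log N)` bits, `N` the
length of the input: there are one program `p` and constants `c`, `C` such that with every word
size of at least `c * log₂ (N + 2)` bits, `p` halts within `C * f(size)` steps, with `1` in register
`0` exactly on the yes-instances. -/
def DecisionProblem.SolvableInTime (Pb : DecisionProblem) (f : ℕ → ℝ) : Prop :=
  ∃ (p : WordRAM.Prog) (c : ℕ) (C : ℝ), ∀ (I : Pb.Inst) (w : ℕ),
    ((Pb.words I).length + 2) ^ c ≤ 2 ^ w →
      ∃ (t : ℕ) (s : WordRAM.State), WordRAM.Run w p (WordRAM.init (Pb.words I)) t s ∧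
        (t : ℝ) ≤ C * f (Pb.size I) ∧ (s.reg 0 = 1 ↔ Pb.Yes I)

/-! ### Orthogonal vectors -/

/-- Two families of `n ≥ 1` vectors each in `{0,1}^d`, with `d = d(n)`. -/
structure OVInstance (d : ℕ → ℕ) where
  n : ℕ
  one_le : 1 ≤ n
  A : Fin n → Fin (d n) → Bool
  B : Fin n → Fin (d n) → Bool

/-- The entries of a 0-1 matrix, row by row. -/
def bitWords {n d : ℕ} (A : Fin n → Fin d → Bool) : List ℕ :=
  (List.ofFn fun i => List.ofFn fun j => (A i j).toNat).flatten

/-- The orthogonal vectors problem in dimension `d = d(n)`. -/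
def orthogonalVectors (d : ℕ → ℕ) : DecisionProblem where
  Inst := OVInstance d
  size := fun I => I.n
  words := fun I => I.n :: d I.n :: (bitWords I.A ++ bitWords I.B)
  Yes := fun I => ∃ i j, ∑ k, (I.A i k).toNat * (I.B j k).toNat = 0

/-- The Orthogonal Vectors Conjecture: in dimension `d = ω(log n)`, orthogonal vectors cannot be
decided in time `O(n ^ (2 - ε))`, for any `ε > 0`. -/
def OrthogonalVectorsConjecture : Prop :=
  ∀ d : ℕ → ℕ, (fun n : ℕ => Real.log n) =o[Filter.atTop] (fun n : ℕ => (d n : ℝ)) →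
    ∀ ε : ℝ, 0 < ε →
      ¬ (orthogonalVectors d).SolvableInTime fun n => (n : ℝ) ^ (2 - ε)

/-! ### Polylines and the barking distance -/

/-- The Euclidean plane. -/
abbrev Plane : Type := EuclideanSpace ℝ (Fin 2)

namespace Polyline

/-- The Euclidean length of a polyline. -/
noncomputable def length : List Plane → ℝ
  | [] => 0
  | [_] => 0
  | p :: q :: l => dist p q + length (q :: l)

/-- The traversal of a polyline at unit speed: `point l t` is the point of `l` at distance `t` from
the first vertex along `l`, for `0 ≤ t ≤ length l`. -/
noncomputable def point : List Plane → ℝ → Plane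
  | [], _ => 0
  | [p], _ => p
  | p :: q :: l, t =>
      if t ≤ dist p q then AffineMap.lineMap p q (t / dist p q)
      else point (q :: l) (t - dist p q)

/-- The set of points on a polyline. -/
def carrier (l : List Plane) : Set Plane := point l '' Set.Icc 0 (length l)

/-- A simple polyline: no repeated vertices and no self-intersections. -/
def IsSimple (l : List Plane) : Prop :=
  l.Nodup ∧ Set.InjOn (point l) (Set.Icc 0 (length l))

/-- A walk `γ` of the dog along `Q` while the hiker traverses `P` at unit speed: it leads from the
start to the end of `Q`, forwards and backwards, with speed at most `s`. -/
structure IsWalk (s : ℝ≥0) (P Q : List Plane) (γ : ℝ → ℝ) : Prop where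
  mapsTo : Set.MapsTo γ (Set.Icc 0 (length P)) (Set.Icc 0 (length Q))
  start : γ 0 = 0
  finish : γ (length P) = length Q
  speed : LipschitzOnWith s γ (Set.Icc 0 (length P))

/-- The threshold function: `1` if the points are more than `ρ` apart, else `0`. -/
noncomputable def threshold (ρ : ℝ) (p q : Plane) : ℝ≥0∞ :=
  if ρ < dist p q then 1 else 0

/-- The (continuous) barking distance from `P` to `Q`: the least time that the hiker on `P` spends
out of the barking radius `ρ` of a dog on `Q` of maximum speed `s` (`∞` if the dog has no walk). -/
noncomputable def barkingDistance (ρ : ℝ) (s : ℝ≥0) (P Q : List Plane) : ℝ≥0∞ :=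
  ⨅ (γ : ℝ → ℝ) (_ : IsWalk s P Q γ),
    ∫⁻ t in Set.Icc 0 (length P), threshold ρ (point P t) (point Q (γ t))

end Polyline

/-! ### The barking decision problem -/

/-- A point with rational coordinates `x / den` and `y / den` (not necessarily in lowest terms). -/
structure RatPoint where
  x : ℤ
  y : ℤ
  den : ℕ
  den_pos : 0 < den

/-- The point of the plane. -/
noncomputable def RatPoint.toPlane (v : RatPoint) : Plane :=
  !₂[(v.x : ℝ) / v.den, (v.y : ℝ) / v.den]

/-- Five words for a point: sign and absolute value of the numerators, and the denominator. -/
def RatPoint.words (v : RatPoint) : List ℕ :=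
  [if v.x < 0 then 1 else 0, v.x.natAbs, if v.y < 0 then 1 else 0, v.y.natAbs, v.den]

/-- All numerators and denominators are at most `b`. -/
def RatPoint.BoundedBy (v : RatPoint) (b : ℕ) : Prop :=
  v.x.natAbs ≤ b ∧ v.y.natAbs ≤ b ∧ v.den ≤ b

/-- The polyline in the plane with the given vertices. -/
noncomputable def ratPolyline {n : ℕ} (P : Fin n → RatPoint) : List Plane :=
  List.ofFn fun i => (P i).toPlane

/-- Two disjoint simple polylines with `n ≥ 2` vertices each, whose coordinates are rationals with
numerators and denominators at most `n ^ κ`. -/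
structure BarkingInstance (κ : ℕ) where
  n : ℕ
  two_le : 2 ≤ n
  P : Fin n → RatPoint
  Q : Fin n → RatPoint
  bounded_P : ∀ i, (P i).BoundedBy (n ^ κ)
  bounded_Q : ∀ i, (Q i).BoundedBy (n ^ κ)
  simple_P : Polyline.IsSimple (ratPolyline P)
  simple_Q : Polyline.IsSimple (ratPolyline Q)
  disjoint : Disjoint (Polyline.carrier (ratPolyline P)) (Polyline.carrier (ratPolyline Q))

/-- The barking decision problem with fixed barking radius `ρ`, for a dog whose maximum speed is the
speed of the hiker: is the barking distance zero? -/
noncomputable def barkingDecision (ρ : ℝ) (κ : ℕ) : DecisionProblem where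
  Inst := BarkingInstance κ
  size := fun I => I.n
  words := fun I => I.n ::
    ((List.ofFn fun i => (I.P i).words).flatten ++ (List.ofFn fun i => (I.Q i).words).flatten)
  Yes := fun I => Polyline.barkingDistance ρ 1 (ratPolyline I.P) (ratPolyline I.Q) = 0

/-!
An instance of orthogonal vectors with `n` vectors of dimension `d` is encoded by two zigzags with
`O(n * d)` edges, one for the vectors of the hiker and one for those of the dog. They are so flat
that only the horizontal coordinates of the vertices matter, which are integral levels in a unit `u`
with `13 / 4 * u ≤ ρ < 7 / 2 * u`. That of the dog is shifted by three units, so a dog at level `D`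
is in reach of a hiker at level `H` of the same parity exactly when `D ≤ H ≤ D + 6`. A walk of
speed one can be rounded to vertices of the right parity, after which the dog moves one edge back or
forth for every edge of the hiker.

The hiker idles at levels `5` and `6` while the dog chooses a vector, descends to level `0` to pin
the dog at the start of a block, and passes the gadgets of all his vectors, complemented, at levels
at most `4`. Finally he climbs to level `11`, which only a dog on a peak of level `5` survives. As
the dog cannot pass a peak before, it has to cross the gadget of the chosen vector while the hiker
crosses one of his gadgets, and it stays below the hiker if and only if these vectors have no common
entry `1`.

The entries of the instance are given by fixed arithmetic expressions in the position and the input,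
so that a word RAM writes them down in time `O(n * d)`. For `d = n ^ δ` with small `δ`, a
subquadratic decision of the barking problem is then a subquadratic decision of orthogonal vectors
in a superlogarithmic dimension.
-/

/-! ### Levels of the two polylines -/

namespace BarkingReduction

/-- Sequences moving up or down by exactly one in each step: the levels of the vertices of a
zigzag polyline. -/
def UnitSteps (u : ℕ → ℕ) : Prop :=
  ∀ k, u (k + 1) = u k + 1 ∨ u k = u (k + 1) + 1

theorem UnitSteps.mod_two {u : ℕ → ℕ} (hu : UnitSteps u) (k : ℕ) : u k % 2 = (u 0 + k) % 2 := by
  induction k with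
  | zero => rfl
  | succ k ih => have := hu k; omega

/-- The profile of a 0-1 vector: four unit steps per coordinate, forming one wave of height two for
the entry `1` and two waves of height one for the entry `0`. -/
def wave (row : ℕ → Bool) (o : ℕ) : ℕ :=
  if o % 4 = 2 then 2 * (row (o / 4)).toNat else o % 2

theorem wave_mod_two (row : ℕ → Bool) (o : ℕ) : wave row o % 2 = o % 2 := by
  unfold wave
  split_ifs <;> omega

theorem wave_le_two (row : ℕ → Bool) (o : ℕ) : wave row o ≤ 2 := by
  have := Bool.toNat_le (row (o / 4))
  unfold wave
  split_ifs <;> omega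

theorem wave_four_mul (row : ℕ → Bool) (c : ℕ) : wave row (4 * c) = 0 := by
  unfold wave
  split_ifs <;> omega

theorem wave_four_mul_add_two (row : ℕ → Bool) (c : ℕ) :
    wave row (4 * c + 2) = 2 * (row c).toNat := by
  rw [wave, if_pos (by omega), show (4 * c + 2) / 4 = c by omega]

theorem unitSteps_wave (row : ℕ → Bool) : UnitSteps (wave row) := fun o => by
  have := wave_mod_two row o
  have := wave_mod_two row (o + 1)
  have := wave_le_two row o
  have := wave_le_two row (o + 1)
  omega

theorem wave_le_wave {u v : ℕ → Bool} {d o : ℕ} (h : ∀ c < d, u c ≤ v c) (ho : o ≤ 4 * d) :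
    wave u o ≤ wave v o := by
  unfold wave
  split_ifs with hc
  · exact Nat.mul_le_mul_left 2 (Bool.toNat_le_toNat (h _ (by omega)))
  · exact le_rfl

/-- Vectors `u`, `v` in `{0,1}^d` have no common entry `1`. -/
def Orthogonal (d : ℕ) (u v : ℕ → Bool) : Prop :=
  ∀ c < d, u c = false ∨ v c = false

/-- Some pair of one of the `n` vectors `α` and one of the `n` vectors `β` is orthogonal. -/
def HasOrthogonalPair (n d : ℕ) (α β : ℕ → ℕ → Bool) : Prop :=
  ∃ i < n, ∃ j < n, Orthogonal d (α i) (β j)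

/-- One block of the dog's polyline, `4 * d + 20` steps long: the gadget of a vector, whose profile
`2 + wave row` lies between valleys of level at most `1`, and the barrier that follows it, with its
peak of level `5` at `4 * d + 7` and a plateau that keeps this peak away from the next block. -/
def dogBlock (d : ℕ) (row : ℕ → Bool) (o : ℕ) : ℕ :=
  if o ≤ 1 then o
  else if o ≤ 4 * d + 2 then 2 + wave row (o - 2)
  else if o ≤ 4 * d + 7 then o - (4 * d + 2)
  else if o ≤ 4 * d + 10 then 4 * d + 12 - o
  else if o ≤ 4 * d + 18 then 2 + o % 2
  else 4 * d + 20 - o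

/-- The position at which block `j` of the dog's polyline starts. -/
def blockStart (d j : ℕ) : ℕ := j * (4 * d + 20)

/-- The level of the dog's polyline after `m` steps, for the vectors `β`. -/
def dogLevel (d : ℕ) (β : ℕ → ℕ → Bool) (m : ℕ) : ℕ :=
  dogBlock d (β (m / (4 * d + 20))) (m % (4 * d + 20))

section Dog

variable {d : ℕ} {β : ℕ → ℕ → Bool}

theorem blockStart_zero : blockStart d 0 = 0 := Nat.zero_mul _

theorem blockStart_succ (j : ℕ) : blockStart d (j + 1) = blockStart d j + (4 * d + 20) :=
  Nat.succ_mul j _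

theorem blockStart_mono : Monotone (blockStart d) := fun _ _ h => Nat.mul_le_mul_right _ h

theorem blockStart_lt_iff {i j : ℕ} : blockStart d i < blockStart d j ↔ i < j :=
  Nat.mul_lt_mul_right (by omega)

theorem blockStart_mod_two (j : ℕ) : blockStart d j % 2 = 0 := by
  rw [blockStart, show j * (4 * d + 20) = 2 * (j * (2 * d + 10)) by ring, Nat.mul_mod_right]

theorem exists_eq_blockStart_add (d m : ℕ) : ∃ j, ∃ o < 4 * d + 20, m = blockStart d j + o :=
  ⟨m / (4 * d + 20), m % (4 * d + 20), Nat.mod_lt _ (by omega), (Nat.div_add_mod' _ _).symm⟩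

theorem dogLevel_blockStart_add (j : ℕ) {o : ℕ} (ho : o ≤ 4 * d + 20) :
    dogLevel d β (blockStart d j + o) = dogBlock d (β j) o := by
  rcases ho.lt_or_eq with ho | rfl
  · rw [dogLevel, blockStart, mul_comm j, Nat.mul_add_div (by omega), Nat.mul_add_mod,
      Nat.mod_eq_of_lt ho, Nat.div_eq_of_lt ho, add_zero]
  · rw [← blockStart_succ, dogLevel, blockStart, Nat.mul_mod_left]
    simp [dogBlock]

theorem dogBlock_step (row : ℕ → Bool) {o : ℕ} (ho : o < 4 * d + 20) :
    dogBlock d row (o + 1) = dogBlock d row o + 1 ∨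
      dogBlock d row o = dogBlock d row (o + 1) + 1 := by
  have hstart : wave row 0 = 0 := wave_four_mul row 0
  have hend := wave_four_mul row d
  unfold dogBlock
  rcases (by omega : o ≤ 1 ∨ 2 ≤ o ∧ o < 4 * d + 2 ∨ o = 4 * d + 2 ∨ 4 * d + 2 < o) with
    h | ⟨h, hd⟩ | rfl | h
  · interval_cases o <;> simp [hstart]
  · have hwave := unitSteps_wave row (o - 2)
    rw [show o - 2 + 1 = o + 1 - 2 by omega] at hwave
    split_ifs <;> omega
  · rw [show 4 * d + 2 - 2 = 4 * d by omega]
    split_ifs <;> omega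
  · split_ifs <;> omega

theorem unitSteps_dogLevel : UnitSteps (dogLevel d β) := fun m => by
  obtain ⟨j, o, ho, rfl⟩ := exists_eq_blockStart_add d m
  rw [add_assoc, dogLevel_blockStart_add j ho, dogLevel_blockStart_add j ho.le]
  exact dogBlock_step (β j) ho

theorem dogLevel_zero : dogLevel d β 0 = 0 := by
  simp [dogLevel, dogBlock]

theorem dogLevel_mod_two (m : ℕ) : dogLevel d β m % 2 = m % 2 := by
  rw [unitSteps_dogLevel.mod_two, dogLevel_zero, zero_add]

theorem dogBlock_le_five (row : ℕ → Bool) (o : ℕ) : dogBlock d row o ≤ 5 := by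
  have := wave_le_two row (o - 2)
  unfold dogBlock
  split_ifs <;> omega

theorem dogLevel_le_five (m : ℕ) : dogLevel d β m ≤ 5 := dogBlock_le_five _ _

theorem dogBlock_eq_five_iff {row : ℕ → Bool} {o : ℕ} : dogBlock d row o = 5 ↔ o = 4 * d + 7 := by
  have := wave_le_two row (o - 2)
  unfold dogBlock
  split_ifs <;> omega

theorem valley_of_dogBlock_le_one {row : ℕ → Bool} {o : ℕ} (ho : o < 4 * d + 20)
    (h : dogBlock d row o ≤ 1) : o ≤ 1 ∨ o = 4 * d + 3 ∨ o = 4 * d + 19 := by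
  unfold dogBlock at h
  split_ifs at h <;> omega

theorem dogBlock_eq_zero_iff {row : ℕ → Bool} {o : ℕ} (ho : o < 4 * d + 20) :
    dogBlock d row o = 0 ↔ o = 0 := by
  unfold dogBlock
  split_ifs <;> omega

theorem dogBlock_add_two (row : ℕ → Bool) {o : ℕ} (ho : o ≤ 4 * d) :
    dogBlock d row (o + 2) = 2 + wave row o := by
  rw [dogBlock, if_neg (by omega), if_pos (by omega), Nat.add_sub_cancel]

end Dog

/-- The gadget of a vector on the hiker's polyline, `4 * d + 2` steps long. The vector is
complemented, so that the dog can keep below the hiker exactly where the two vectors do not share an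
entry `1`. -/
def hikerGadget (d : ℕ) (row : ℕ → Bool) (o : ℕ) : ℕ :=
  if o = 0 then 1
  else if o ≤ 4 * d + 1 then 2 + wave (fun c => !row c) (o - 1)
  else 1

/-- The time at which the hiker enters the gadget of vector `i`; he leaves the last one at time
`slot n d n`. -/
def slot (n d i : ℕ) : ℕ := blockStart d n + 6 + i * (4 * d + 2)

/-- The level of the hiker at time `k`, for the vectors `α`. He idles while the dog chooses a block,
descends to level `0` to pin the dog at the start of a block, passes his gadgets, climbs to level
`11` to request the dog on a peak, and idles again. -/
def hikerLevel (n d : ℕ) (α : ℕ → ℕ → Bool) (k : ℕ) : ℕ :=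
  if k ≤ blockStart d n then 5 + k % 2
  else if k ≤ blockStart d n + 5 then blockStart d n + 5 - k
  else if k < slot n d n then
    hikerGadget d (α ((k - slot n d 0) / (4 * d + 2))) ((k - slot n d 0) % (4 * d + 2))
  else if k ≤ slot n d n + 10 then 1 + (k - slot n d n)
  else if k ≤ slot n d n + 16 then slot n d n + 21 - k
  else 5 + k % 2

section Hiker

variable {n d : ℕ} {α : ℕ → ℕ → Bool}

theorem slot_zero : slot n d 0 = blockStart d n + 6 := by rw [slot, Nat.zero_mul, add_zero]

theorem slot_succ (i : ℕ) : slot n d (i + 1) = slot n d i + (4 * d + 2) := by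
  rw [slot, Nat.succ_mul, ← add_assoc, slot]

theorem slot_mono : Monotone (slot n d) :=
  monotone_nat_of_le_succ fun i => (slot_succ i).symm ▸ Nat.le_add_right _ _

theorem blockStart_add_six_le_slot (i : ℕ) : blockStart d n + 6 ≤ slot n d i := Nat.le_add_right _ _

theorem slot_add_le_slot {i : ℕ} (hi : i < n) : slot n d i + (4 * d + 2) ≤ slot n d n :=
  (slot_succ i).symm.trans_le (slot_mono hi)

theorem slot_mod_two (i : ℕ) : slot n d i % 2 = 0 := by
  have := blockStart_mod_two (d := d) n
  rw [slot, show i * (4 * d + 2) = 2 * (i * (2 * d + 1)) by ring]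
  omega

theorem slot_add_blockStart_le (hn : 1 ≤ n) :
    slot n d n + 16 + blockStart d n ≤ 4 * blockStart d n := by
  have : slot n d n + 16 + blockStart d n + (4 * (n * d) + 38 * n) = 4 * blockStart d n + 22 := by
    unfold slot blockStart
    ring
  omega

theorem hikerGadget_le_four (row : ℕ → Bool) (o : ℕ) : hikerGadget d row o ≤ 4 := by
  have := wave_le_two (fun c => !row c) (o - 1)
  unfold hikerGadget
  split_ifs <;> omega

theorem one_le_hikerGadget (row : ℕ → Bool) (o : ℕ) : 1 ≤ hikerGadget d row o := by
  unfold hikerGadget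
  split_ifs <;> omega

theorem hikerGadget_zero (row : ℕ → Bool) : hikerGadget d row 0 = 1 := if_pos rfl

theorem hikerGadget_period (row : ℕ → Bool) : hikerGadget d row (4 * d + 2) = 1 := by
  rw [hikerGadget, if_neg (by omega), if_neg (by omega)]

theorem hikerGadget_succ (row : ℕ → Bool) {o : ℕ} (ho : o ≤ 4 * d) :
    hikerGadget d row (o + 1) = 2 + wave (fun c => !row c) o := by
  rw [hikerGadget, if_neg (by omega), if_pos (by omega), Nat.add_sub_cancel]

theorem hikerGadget_step (row : ℕ → Bool) {o : ℕ} (ho : o < 4 * d + 2) :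
    hikerGadget d row (o + 1) = hikerGadget d row o + 1 ∨
      hikerGadget d row o = hikerGadget d row (o + 1) + 1 := by
  obtain _ | u := o
  · rw [hikerGadget_succ row (Nat.zero_le _), hikerGadget_zero]
    exact .inl (congrArg (2 + ·) (wave_four_mul _ 0))
  rcases (show u ≤ 4 * d by omega).lt_or_eq with hu | rfl
  · rw [hikerGadget_succ row (o := u + 1) hu, hikerGadget_succ row hu.le]
    have := unitSteps_wave (fun c => !row c) u
    omega
  · rw [hikerGadget_period, hikerGadget_succ row le_rfl, wave_four_mul]
    exact .inr rfl

theorem hikerLevel_idle {k : ℕ} (h : k ≤ blockStart d n) : hikerLevel n d α k = 5 + k % 2 :=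
  if_pos h

theorem hikerLevel_descent {e : ℕ} (he : e ≤ 5) :
    hikerLevel n d α (blockStart d n + e) = 5 - e := by
  have := blockStart_mod_two (d := d) n
  unfold hikerLevel
  split_ifs <;> omega

theorem hikerLevel_climb {e : ℕ} (he : e ≤ 10) : hikerLevel n d α (slot n d n + e) = 1 + e := by
  have := blockStart_add_six_le_slot (d := d) (n := n) n
  unfold hikerLevel
  split_ifs <;> omega

theorem hikerLevel_slot_add {i o : ℕ} (hi : i < n) (ho : o ≤ 4 * d + 2) :
    hikerLevel n d α (slot n d i + o) = hikerGadget d (α i) o := by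
  have inside : ∀ {i o}, i < n → o < 4 * d + 2 →
      hikerLevel n d α (slot n d i + o) = hikerGadget d (α i) o := fun {i o} hi ho => by
    have hn := slot_add_le_slot (d := d) hi
    have h0 := blockStart_add_six_le_slot (d := d) (n := n) i
    have hsub : slot n d i + o - slot n d 0 = (4 * d + 2) * i + o := by
      rw [slot_zero, slot, mul_comm i]
      omega
    rw [hikerLevel, if_neg (by omega), if_neg (by omega), if_pos (by omega), hsub,
      Nat.mul_add_div (by omega), Nat.mul_add_mod, Nat.mod_eq_of_lt ho, Nat.div_eq_of_lt ho,
      add_zero]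
  rcases ho.lt_or_eq with ho | rfl
  · exact inside hi ho
  rw [hikerGadget_period, ← slot_succ, ← add_zero (slot n d (i + 1))]
  rcases (Nat.succ_le_of_lt hi).lt_or_eq with hi' | hi'
  · rw [inside hi' (by omega), hikerGadget_zero]
  · rw [show i + 1 = n from hi', hikerLevel_climb (Nat.zero_le _)]

theorem hikerLevel_slot {i : ℕ} (hi : i ≤ n) : hikerLevel n d α (slot n d i) = 1 := by
  rw [← add_zero (slot n d i)]
  rcases hi.lt_or_eq with hi | rfl
  · rw [hikerLevel_slot_add hi (Nat.zero_le _), hikerGadget_zero]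
  · rw [hikerLevel_climb (Nat.zero_le _)]

theorem hikerLevel_return {e : ℕ} (he : e ≤ 6) :
    hikerLevel n d α (slot n d n + 10 + e) = 11 - e := by
  have := blockStart_add_six_le_slot (d := d) (n := n) n
  unfold hikerLevel
  split_ifs <;> omega

theorem hikerLevel_idle_again (e : ℕ) : hikerLevel n d α (slot n d n + 16 + e) = 5 + e % 2 := by
  have := blockStart_add_six_le_slot (d := d) (n := n) n
  have := slot_mod_two (d := d) (n := n) n
  unfold hikerLevel
  split_ifs <;> omega

theorem exists_eq_slot_add {k : ℕ} (h0 : slot n d 0 ≤ k) (hn : k < slot n d n) :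
    ∃ i < n, ∃ o < 4 * d + 2, k = slot n d i + o := by
  have hpos : 0 < 4 * d + 2 := by omega
  rw [slot_zero] at h0
  refine ⟨(k - (blockStart d n + 6)) / (4 * d + 2), ?_, (k - (blockStart d n + 6)) % (4 * d + 2),
    Nat.mod_lt _ hpos, ?_⟩
  · rw [Nat.div_lt_iff_lt_mul hpos]
    unfold slot at hn
    omega
  · have := Nat.div_add_mod' (k - (blockStart d n + 6)) (4 * d + 2)
    unfold slot
    omega

theorem exists_phase (n d k : ℕ) :
    k < blockStart d n ∨ (∃ e < 5, k = blockStart d n + e) ∨ k = blockStart d n + 5 ∨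
      (∃ i < n, ∃ o < 4 * d + 2, k = slot n d i + o) ∨ (∃ e < 10, k = slot n d n + e) ∨
      (∃ e < 6, k = slot n d n + 10 + e) ∨ ∃ e, k = slot n d n + 16 + e := by
  have h0 := slot_zero (n := n) (d := d)
  rcases Nat.lt_or_ge k (blockStart d n) with h | h
  · exact .inl h
  rcases Nat.lt_or_ge k (blockStart d n + 5) with h5 | h5
  · exact .inr (.inl ⟨k - blockStart d n, by omega, by omega⟩)
  rcases h5.eq_or_lt with h6 | h6
  · exact .inr (.inr (.inl h6.symm))
  rcases Nat.lt_or_ge k (slot n d n) with hk | hk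
  · exact .inr (.inr (.inr (.inl (exists_eq_slot_add (by omega) hk))))
  rcases Nat.lt_or_ge k (slot n d n + 10) with h10 | h10
  · exact .inr (.inr (.inr (.inr (.inl ⟨k - slot n d n, by omega, by omega⟩))))
  rcases Nat.lt_or_ge k (slot n d n + 16) with h16 | h16
  · exact .inr (.inr (.inr (.inr (.inr (.inl ⟨k - (slot n d n + 10), by omega, by omega⟩)))))
  · exact .inr (.inr (.inr (.inr (.inr (.inr ⟨k - (slot n d n + 16), by omega⟩)))))

theorem unitSteps_hikerLevel : UnitSteps (hikerLevel n d α) := fun k => by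
  rcases exists_phase n d k with h | ⟨e, he, rfl⟩ | rfl | ⟨i, hi, o, ho, rfl⟩ | ⟨e, he, rfl⟩ |
    ⟨e, he, rfl⟩ | ⟨e, rfl⟩
  · rw [hikerLevel_idle h, hikerLevel_idle h.le]
    omega
  · rw [add_assoc, hikerLevel_descent (Nat.succ_le_of_lt he), hikerLevel_descent he.le]
    omega
  · rw [hikerLevel_descent le_rfl, add_assoc, ← slot_zero, hikerLevel_slot (Nat.zero_le _)]
    omega
  · rw [add_assoc, hikerLevel_slot_add hi ho, hikerLevel_slot_add hi ho.le]
    exact hikerGadget_step (α i) ho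
  · rw [add_assoc, hikerLevel_climb (Nat.succ_le_of_lt he), hikerLevel_climb he.le]
    omega
  · rw [add_assoc, hikerLevel_return (Nat.succ_le_of_lt he), hikerLevel_return he.le]
    omega
  · rw [add_assoc, hikerLevel_idle_again, hikerLevel_idle_again]
    omega

theorem hikerLevel_mod_two (k : ℕ) : hikerLevel n d α k % 2 = (k + 1) % 2 := by
  rw [unitSteps_hikerLevel.mod_two, hikerLevel_idle (Nat.zero_le _)]
  omega

theorem hikerLevel_le_eleven (k : ℕ) : hikerLevel n d α k ≤ 11 := by
  have := hikerGadget_le_four (d := d) (α ((k - slot n d 0) / (4 * d + 2)))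
    ((k - slot n d 0) % (4 * d + 2))
  unfold hikerLevel
  split_ifs <;> omega

theorem hikerLevel_le_four {k : ℕ} (h : blockStart d n + 5 ≤ k) (hk : k ≤ slot n d n) :
    hikerLevel n d α k ≤ 4 := by
  have := hikerGadget_le_four (d := d) (α ((k - slot n d 0) / (4 * d + 2)))
    ((k - slot n d 0) % (4 * d + 2))
  unfold hikerLevel
  split_ifs <;> omega

end Hiker

end BarkingReduction

/-! ### Discrete walks of the dog -/

namespace BarkingReduction

/-- The dog at position `m` is in the range of the hiker at time `k`. -/
def InRange (n d : ℕ) (α β : ℕ → ℕ → Bool) (k m : ℕ) : Prop :=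
  dogLevel d β m ≤ hikerLevel n d α k ∧ hikerLevel n d α k ≤ dogLevel d β m + 6

/-- `y` is a walk of the dog on the vertices of its polyline, at most one step at a time, that stays
in the range of the hiker up to time `T`. -/
structure IsDiscreteWalk (n d : ℕ) (α β : ℕ → ℕ → Bool) (T : ℕ) (y : ℕ → ℕ) : Prop where
  step : ∀ k < T, y (k + 1) ≤ y k + 1 ∧ y k ≤ y (k + 1) + 1
  inRange : ∀ k ≤ T, InRange n d α β k (y k)

section Soundness

variable {n d T : ℕ} {α β : ℕ → ℕ → Bool} {y : ℕ → ℕ}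

theorem near_or_crossed_of_dogLevel_le_one {j m : ℕ} (h : dogLevel d β m ≤ 1)
    (hl : blockStart d j < m + 13) (hr : m < blockStart d j + (4 * d + 7)) :
    (m ≤ blockStart d j + 1 ∧ blockStart d j ≤ m + 1) ∨ m = blockStart d j + (4 * d + 3) := by
  rcases Nat.lt_or_ge m (blockStart d j) with hm | hm
  · obtain _ | i := j
    · exact absurd hm (by rw [blockStart_zero]; exact Nat.not_lt_zero m)
    rw [blockStart_succ] at hl hm ⊢
    obtain ⟨o, rfl⟩ := Nat.exists_eq_add_of_le (show blockStart d i ≤ m by omega)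
    rw [dogLevel_blockStart_add i (by omega)] at h
    have := valley_of_dogBlock_le_one (by omega) h
    omega
  · obtain ⟨o, rfl⟩ := Nat.exists_eq_add_of_le hm
    rw [dogLevel_blockStart_add j (by omega)] at h
    have := valley_of_dogBlock_le_one (by omega) h
    omega

namespace IsDiscreteWalk

theorem near (hy : IsDiscreteWalk n d α β T y) (k e : ℕ) (h : k + e ≤ T) :
    y (k + e) ≤ y k + e ∧ y k ≤ y (k + e) + e := by
  induction e with
  | zero => exact ⟨le_rfl, le_rfl⟩
  | succ e ih =>
    have hstep := hy.step (k + e) (by omega)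
    have := ih (by omega)
    rw [← add_assoc k e 1]
    omega

theorem exists_eq_blockStart (hy : IsDiscreteWalk n d α β T y) (hT : blockStart d n + 5 ≤ T) :
    ∃ j, y (blockStart d n + 5) = blockStart d j := by
  have hlow := (hy.inRange _ hT).1
  obtain ⟨j, o, ho, hjo⟩ := exists_eq_blockStart_add d (y (blockStart d n + 5))
  rw [hikerLevel_descent le_rfl, hjo, dogLevel_blockStart_add j ho.le, Nat.le_zero,
    dogBlock_eq_zero_iff ho] at hlow
  exact ⟨j, by rw [hjo, hlow, add_zero]⟩

/-- The barriers on both sides of block `j` have peaks of level `5`, above the hiker. -/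
theorem between_barriers (hy : IsDiscreteWalk n d α β T y) (hT : slot n d n ≤ T) {j : ℕ}
    (hj : y (blockStart d n + 5) = blockStart d j) {k : ℕ} (h5 : blockStart d n + 5 ≤ k)
    (hk : k ≤ slot n d n) :
    blockStart d j < y k + 13 ∧ y k < blockStart d j + (4 * d + 7) := by
  have not_peak : ∀ l, blockStart d n + 5 ≤ l → l ≤ slot n d n → ∀ i,
      y l ≠ blockStart d i + (4 * d + 7) := fun l h5 hl i hpeak => by
    have hrange := (hy.inRange l (by omega)).1
    have hlow := hikerLevel_le_four (α := α) h5 hl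
    rw [hpeak, dogLevel_blockStart_add i (by omega), dogBlock_eq_five_iff.2 rfl] at hrange
    omega
  induction k, h5 using Nat.le_induction with
  | base => omega
  | succ k h5 ih =>
    have hstep := hy.step k (by omega)
    have := ih (by omega)
    have hright := not_peak (k + 1) (by omega) hk j
    have hleft : y (k + 1) + 13 ≠ blockStart d j := fun h => by
      obtain _ | i := j
      · rw [blockStart_zero] at h
        omega
      · refine not_peak (k + 1) (by omega) hk i ?_
        rw [blockStart_succ] at h
        omega
    omega

/-- Crossing a gadget of the dog while the hiker passes one of his takes all of the available time,
so that the tall waves for a common entry `1` would meet. -/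
theorem orthogonal_of_cross (hy : IsDiscreteWalk n d α β T y) (hT : slot n d n ≤ T) {i j : ℕ}
    (hi : i < n) (hstart : y (slot n d i) ≤ blockStart d j + 1)
    (hend : y (slot n d (i + 1)) = blockStart d j + (4 * d + 3)) : Orthogonal d (α i) (β j) := by
  intro c hc
  have hslot := slot_add_le_slot (d := d) hi
  have hsync : y (slot n d i + (4 * c + 3)) = blockStart d j + (4 * c + 2 + 2) := by
    have hbefore := hy.near (slot n d i) (4 * c + 3) (by omega)
    have hafter := hy.near (slot n d i + (4 * c + 3)) (4 * d + 2 - (4 * c + 3)) (by omega)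
    rw [add_assoc, show 4 * c + 3 + (4 * d + 2 - (4 * c + 3)) = 4 * d + 2 by omega, ← slot_succ,
      hend] at hafter
    omega
  have hrange := (hy.inRange (slot n d i + (4 * c + 3)) (by omega)).1
  rw [hsync, dogLevel_blockStart_add j (by omega), dogBlock_add_two _ (by omega),
    hikerLevel_slot_add hi (by omega), hikerGadget_succ _ (by omega), wave_four_mul_add_two,
    wave_four_mul_add_two] at hrange
  revert hrange
  cases α i c <;> cases β j c <;> simp

theorem near_blockStart (hy : IsDiscreteWalk n d α β T y) (hT : slot n d n ≤ T)
    (hno : ¬HasOrthogonalPair n d α β) (hlen : ∀ k ≤ T, y k ≤ blockStart d n + 1) {j : ℕ}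
    (hj : y (blockStart d n + 5) = blockStart d j) {i : ℕ} (hi : i ≤ n) :
    y (slot n d i) ≤ blockStart d j + 1 ∧ blockStart d j ≤ y (slot n d i) + 1 := by
  induction i with
  | zero =>
    have h0 := slot_mono (n := n) (d := d) hi
    rw [slot_zero] at h0 ⊢
    have hstep := hy.step (blockStart d n + 5) (by omega)
    rwa [add_assoc, hj] at hstep
  | succ i ih =>
    have hslot := slot_mono (n := n) (d := d) hi
    have h0 := blockStart_add_six_le_slot (d := d) (n := n) (i + 1)
    have hvalley := (hy.inRange (slot n d (i + 1)) (by omega)).1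
    rw [hikerLevel_slot hi] at hvalley
    have hbetween := hy.between_barriers hT hj (k := slot n d (i + 1)) (by omega) hslot
    refine (near_or_crossed_of_dogLevel_le_one hvalley hbetween.1 hbetween.2).resolve_right
      fun hcross => ?_
    have hjn : blockStart d j < blockStart d n := by
      have := hlen _ (hslot.trans hT)
      omega
    exact hno ⟨i, hi, j, blockStart_lt_iff.1 hjn,
      hy.orthogonal_of_cross hT hi (ih (Nat.le_of_succ_le hi)).1 hcross⟩

/-- Ten steps after leaving the gadgets, the hiker at level `11` requires the dog to be on a peak,
which is too far away if the dog is still at the start of a block. -/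
theorem hasOrthogonalPair (hy : IsDiscreteWalk n d α β T y) (hd : 2 ≤ d)
    (hT : slot n d n + 10 ≤ T) (hlen : ∀ k ≤ T, y k ≤ blockStart d n + 1) :
    HasOrthogonalPair n d α β := by
  by_contra hno
  have h0 := blockStart_add_six_le_slot (d := d) (n := n) n
  obtain ⟨j, hj⟩ := hy.exists_eq_blockStart (by omega)
  have hstart := hy.near_blockStart (by omega) hno hlen hj le_rfl
  have hnear := hy.near (slot n d n) 10 hT
  have hpeak := (hy.inRange (slot n d n + 10) hT).2
  obtain ⟨i, o, ho, hio⟩ := exists_eq_blockStart_add d (y (slot n d n + 10))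
  rw [hikerLevel_climb le_rfl, hio, dogLevel_blockStart_add i ho.le] at hpeak
  have ho7 : o = 4 * d + 7 :=
    dogBlock_eq_five_iff.1 (le_antisymm (dogBlock_le_five (β i) o) (by omega))
  rcases Nat.lt_or_ge i j with hij | hij
  · have := blockStart_mono (d := d) (Nat.succ_le_of_lt hij)
    rw [Nat.succ_eq_add_one, blockStart_succ] at this
    omega
  · have := blockStart_mono (d := d) hij
    omega

end IsDiscreteWalk

end Soundness

/-- The walk of the dog that crosses gadget `j` while the hiker passes gadget `i`: it goes to the
start of block `j` and waits, crosses, waits, climbs the barrier while the hiker does, and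
finally, while the hiker idles, proceeds to its end. -/
def dogWalk (n d i j k : ℕ) : ℕ :=
  min k (blockStart d j) + min (k + 1 - slot n d i) (4 * d + 3) + min (k - (slot n d n + 6)) 4 +
    min (k - (slot n d n + 16)) (blockStart d n - (blockStart d j + (4 * d + 7)))

section Completeness

variable {n d i j : ℕ} {α β : ℕ → ℕ → Bool}

theorem dogWalk_zero : dogWalk n d i j 0 = 0 := by
  have := blockStart_add_six_le_slot (d := d) (n := n) i
  unfold dogWalk
  omega

theorem blockStart_add_period_le (hj : j < n) : blockStart d j + (4 * d + 20) ≤ blockStart d n :=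
  (blockStart_succ j).symm.trans_le (blockStart_mono hj)

theorem dogWalk_succ (hi : i < n) (hj : j < n) (k : ℕ) :
    dogWalk n d i j (k + 1) = dogWalk n d i j k ∨
      dogWalk n d i j (k + 1) = dogWalk n d i j k + 1 := by
  have := blockStart_add_period_le (d := d) hj
  have := blockStart_add_six_le_slot (d := d) (n := n) i
  have := slot_add_le_slot (d := d) hi
  unfold dogWalk
  omega

theorem dogWalk_of_le (hi : i < n) (hj : j < n) {k : ℕ}
    (hk : slot n d n + 16 + blockStart d n ≤ k) : dogWalk n d i j k = blockStart d n := by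
  have := blockStart_add_period_le (d := d) hj
  have := slot_add_le_slot (d := d) hi
  unfold dogWalk
  omega

theorem inRange_of_hikerLevel {k : ℕ} (h : hikerLevel n d α k = 5 + k % 2) (m : ℕ) :
    InRange n d α β k m := by
  have := dogLevel_le_five (d := d) (β := β) m
  unfold InRange
  omega

theorem inRange_blockStart {k : ℕ} (hk : k ≤ slot n d n) :
    InRange n d α β k (blockStart d j) := by
  have hdog : dogLevel d β (blockStart d j) = 0 := by
    rw [← add_zero (blockStart d j), dogLevel_blockStart_add j (Nat.zero_le _)]
    exact if_pos (Nat.zero_le 1)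
  have hhiker : hikerLevel n d α k ≤ 6 := by
    rcases Nat.le_total k (blockStart d n) with h | h
    · rw [hikerLevel_idle h]
      omega
    obtain ⟨e, rfl⟩ := Nat.exists_eq_add_of_le h
    rcases Nat.le_total e 5 with he | he
    · rw [hikerLevel_descent he]
      omega
    · exact (hikerLevel_le_four (by omega) hk).trans (by norm_num)
  exact ⟨hdog ▸ Nat.zero_le _, hdog ▸ hhiker⟩

theorem dogBlock_succ_le_hikerGadget {u v : ℕ → Bool} (h : Orthogonal d u v) {o : ℕ}
    (ho : o ≤ 4 * d + 2) : dogBlock d v (o + 1) ≤ hikerGadget d u o := by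
  obtain _ | o := o
  · exact le_rfl
  rcases (show o ≤ 4 * d + 1 by omega).lt_or_eq with ho | rfl
  · rw [dogBlock_add_two v (by omega), hikerGadget_succ u (by omega)]
    refine Nat.add_le_add_left (wave_le_wave (d := d) (fun c hc => ?_) (by omega)) 2
    rcases h c hc with h | h <;> simp [h]
  · rw [hikerGadget_period]
    unfold dogBlock
    split_ifs <;> omega

theorem inRange_gadget (hi : i < n) (h : Orthogonal d (α i) (β j)) {o : ℕ} (ho : o ≤ 4 * d + 2) :
    InRange n d α β (slot n d i + o) (blockStart d j + (o + 1)) := by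
  rw [InRange, hikerLevel_slot_add hi ho, dogLevel_blockStart_add j (by omega)]
  have := hikerGadget_le_four (d := d) (α i) o
  exact ⟨dogBlock_succ_le_hikerGadget h ho, by omega⟩

theorem inRange_valley {k : ℕ} (h0 : slot n d 0 ≤ k) (hk : k ≤ slot n d n + 6) :
    InRange n d α β k (blockStart d j + (4 * d + 3)) := by
  have hdog : dogBlock d (β j) (4 * d + 3) = 1 := by
    unfold dogBlock
    split_ifs <;> omega
  rw [InRange, dogLevel_blockStart_add j (by omega), hdog]
  rcases Nat.lt_or_ge k (slot n d n) with hkn | hkn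
  · obtain ⟨i, hi, o, ho, rfl⟩ := exists_eq_slot_add h0 hkn
    rw [hikerLevel_slot_add hi ho.le]
    have := hikerGadget_le_four (d := d) (α i) o
    exact ⟨one_le_hikerGadget _ _, by omega⟩
  · obtain ⟨e, rfl⟩ := Nat.exists_eq_add_of_le hkn
    rw [hikerLevel_climb (by omega)]
    omega

theorem inRange_climb {e : ℕ} (he : e ≤ 4) :
    InRange n d α β (slot n d n + 6 + e) (blockStart d j + (4 * d + 3 + e)) := by
  rw [InRange, add_assoc _ 6, hikerLevel_climb (by omega), dogLevel_blockStart_add j (by omega)]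
  unfold dogBlock
  split_ifs <;> omega

theorem inRange_peak {e : ℕ} (he : e ≤ 6) :
    InRange n d α β (slot n d n + 10 + e) (blockStart d j + (4 * d + 7)) := by
  rw [InRange, hikerLevel_return he, dogLevel_blockStart_add j (by omega),
    dogBlock_eq_five_iff.2 rfl]
  omega

theorem inRange_dogWalk (hi : i < n) (hj : j < n) (h : Orthogonal d (α i) (β j)) (k : ℕ) :
    InRange n d α β k (dogWalk n d i j k) := by
  have hblock := blockStart_add_period_le (d := d) hj
  have hslot := slot_add_le_slot (d := d) hi
  have hsi := blockStart_add_six_le_slot (d := d) (n := n) i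
  have position : ∀ {m}, InRange n d α β k m → dogWalk n d i j k = m →
      InRange n d α β k (dogWalk n d i j k) := fun hm e => e ▸ hm
  rcases Nat.le_total k (blockStart d n) with h1 | h1
  · exact inRange_of_hikerLevel (hikerLevel_idle h1) _
  rcases Nat.lt_or_ge k (slot n d i) with h2 | h2
  · exact position (inRange_blockStart (j := j) (by omega)) (by unfold dogWalk; omega)
  rcases Nat.le_total k (slot n d i + (4 * d + 2)) with h3 | h3
  · obtain ⟨o, rfl⟩ := Nat.exists_eq_add_of_le h2
    exact position (inRange_gadget hi h (by omega)) (by unfold dogWalk; omega)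
  rcases Nat.le_total k (slot n d n + 6) with h4 | h4
  · exact position (inRange_valley (j := j) (slot_zero.trans_le (by omega)) h4)
      (by unfold dogWalk; omega)
  rcases Nat.le_total k (slot n d n + 10) with h5 | h5
  · obtain ⟨e, rfl⟩ := Nat.exists_eq_add_of_le h4
    exact position (inRange_climb (j := j) (by omega)) (by unfold dogWalk; omega)
  rcases Nat.le_total k (slot n d n + 16) with h6 | h6
  · obtain ⟨e, rfl⟩ := Nat.exists_eq_add_of_le h5
    exact position (inRange_peak (j := j) (by omega)) (by unfold dogWalk; omega)
  · obtain ⟨e, rfl⟩ := Nat.exists_eq_add_of_le h6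
    refine inRange_of_hikerLevel ?_ _
    have := slot_mod_two (d := d) (n := n) n
    rw [hikerLevel_idle_again]
    omega

end Completeness

end BarkingReduction

/-! ### Piecewise linear interpolation -/

namespace BarkingReduction

section Interpolation

open AffineMap

variable {E : Type*} [NormedAddCommGroup E] [NormedSpace ℝ E]

/-- The piecewise linear function on `[0, ∞)` with the value `v k` at the integer `k`. -/
noncomputable def interpolate (v : ℕ → E) (t : ℝ) : E :=
  lineMap (v ⌊t⌋₊) (v (⌊t⌋₊ + 1)) (t - ⌊t⌋₊)

theorem exists_eq_natCast_add {t : ℝ} (ht : 0 ≤ t) :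
    ∃ (k : ℕ) (θ : ℝ), 0 ≤ θ ∧ θ ≤ 1 ∧ t = k + θ :=
  ⟨⌊t⌋₊, t - ⌊t⌋₊, sub_nonneg.2 (Nat.floor_le ht),
    sub_le_iff_le_add'.2 (Nat.lt_floor_add_one t).le, (add_sub_cancel _ t).symm⟩

theorem interpolate_natCast_add (v : ℕ → E) (k : ℕ) {θ : ℝ} (h0 : 0 ≤ θ) (h1 : θ ≤ 1) :
    interpolate v (k + θ) = lineMap (v k) (v (k + 1)) θ := by
  rcases h1.lt_or_eq with h1 | rfl
  · have hfloor : ⌊(k : ℝ) + θ⌋₊ = k :=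
      (Nat.floor_eq_iff (by positivity)).2 ⟨by linarith, by linarith⟩
    rw [interpolate, hfloor, add_sub_cancel_left]
  · rw [interpolate, ← Nat.cast_succ, Nat.floor_natCast, sub_self, lineMap_apply_zero,
      lineMap_apply_one]

theorem interpolate_natCast (v : ℕ → E) (k : ℕ) : interpolate v k = v k := by
  simpa only [add_zero, lineMap_apply_zero] using interpolate_natCast_add v k le_rfl zero_le_one

theorem interpolate_zero (v : ℕ → E) : interpolate v 0 = v 0 :=
  Nat.cast_zero (R := ℝ) ▸ interpolate_natCast v 0

theorem interpolate_add_one (v : ℕ → E) {t : ℝ} (ht : 0 ≤ t) :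
    interpolate v (t + 1) = interpolate (fun k => v (k + 1)) t := by
  rw [interpolate, interpolate, Nat.floor_add_one ht, Nat.cast_succ, add_sub_add_right_eq_sub]

theorem interpolate_const_smul (c : ℝ) (v : ℕ → E) (t : ℝ) :
    interpolate (fun k => c • v k) t = c • interpolate v t :=
  ((LinearMap.lsmul ℝ E c).toAffineMap.apply_lineMap _ _ _).symm

theorem interpolate_add_const (v : ℕ → E) (e : E) (t : ℝ) :
    interpolate (fun k => v k + e) t = interpolate v t + e :=
  ((AffineEquiv.vaddConst ℝ e).toAffineMap.apply_lineMap _ _ _).symm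

theorem interpolate_sub (v w : ℕ → E) (t : ℝ) :
    interpolate (fun k => v k - w k) t = interpolate v t - interpolate w t := by
  simp only [interpolate, lineMap_apply_module]
  module

theorem interpolate_mem_of_convex {s : Set E} (hs : Convex ℝ s) {v : ℕ → E} (hv : ∀ k, v k ∈ s)
    {t : ℝ} (ht : 0 ≤ t) : interpolate v t ∈ s :=
  hs.lineMap_mem (hv _) (hv _) ⟨sub_nonneg.2 (Nat.floor_le ht),
    sub_le_iff_le_add'.2 (Nat.lt_floor_add_one t).le⟩

theorem dist_interpolate_interpolate_le {v w : ℕ → E} {r : ℝ} (h : ∀ k, dist (v k) (w k) ≤ r)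
    {t : ℝ} (ht : 0 ≤ t) : dist (interpolate v t) (interpolate w t) ≤ r := by
  rw [dist_eq_norm, ← interpolate_sub, ← mem_closedBall_zero_iff]
  exact interpolate_mem_of_convex (convex_closedBall 0 r)
    (fun k => mem_closedBall_zero_iff.2 (dist_eq_norm (v k) (w k) ▸ h k)) ht

theorem interpolate_natCast_add_div (v : ℕ → E) {c : ℕ} (hc : 0 < c) (i : ℕ) {θ : ℝ} (h0 : 0 ≤ θ)
    (h1 : θ ≤ 1) : interpolate v ((i + θ) / c) =
      lineMap (v (i / c)) (v (i / c + 1)) (((i % c : ℕ) + θ) / c) := by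
  have hi : ((i : ℝ) + θ) / c = (i / c : ℕ) + ((i % c : ℕ) + θ) / c := by
    have : (i : ℝ) = c * (i / c : ℕ) + (i % c : ℕ) := by exact_mod_cast (Nat.div_add_mod i c).symm
    rw [this]
    field_simp
    ring
  have hmod : ((i % c : ℕ) : ℝ) + 1 ≤ c := by exact_mod_cast Nat.mod_lt i hc
  rw [hi, interpolate_natCast_add v _ (by positivity)
    (div_le_one_of_le₀ (by linarith) (Nat.cast_nonneg c))]

theorem interpolate_subdivide (v : ℕ → E) {c : ℕ} (hc : 0 < c) {t : ℝ} (ht : 0 ≤ t) :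
    interpolate (fun i => interpolate v ((i : ℝ) / c)) t = interpolate v (t / c) := by
  obtain ⟨i, θ, h0, h1, rfl⟩ := exists_eq_natCast_add ht
  rw [interpolate_natCast_add _ _ h0 h1, interpolate_natCast_add_div v hc i h0 h1, Nat.cast_succ,
    interpolate_natCast_add_div v hc i zero_le_one le_rfl, ← add_zero (i : ℝ),
    interpolate_natCast_add_div v hc i le_rfl zero_le_one, ← apply_lineMap, lineMap_apply_ring']
  ring_nf

theorem dist_interpolate_le {v : ℕ → E} {C : ℝ} (hv : ∀ k, dist (v k) (v (k + 1)) ≤ C) {s t : ℝ}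
    (hs : 0 ≤ s) (ht : 0 ≤ t) : dist (interpolate v s) (interpolate v t) ≤ C * dist s t := by
  wlog hst : s ≤ t generalizing s t
  · rw [dist_comm, dist_comm s]
    exact this ht hs (le_of_not_ge hst)
  have ht0 := Nat.floor_le ht
  have hs1 := Nat.lt_floor_add_one s
  have hdist : dist s t = t - s := by rw [dist_comm, Real.dist_eq, abs_of_nonneg (sub_nonneg.2 hst)]
  rw [hdist]
  unfold interpolate
  rcases (Nat.floor_mono hst).eq_or_lt with heq | hlt
  · rw [← heq, dist_lineMap_lineMap, dist_sub_right, hdist, mul_comm]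
    exact mul_le_mul_of_nonneg_right (hv _) (sub_nonneg.2 hst)
  · have hfirst : dist (lineMap (v ⌊s⌋₊) (v (⌊s⌋₊ + 1)) (s - ⌊s⌋₊)) (v (⌊s⌋₊ + 1)) ≤
        C * (⌊s⌋₊ + 1 - s) := by
      rw [dist_lineMap_right, Real.norm_of_nonneg (by linarith), mul_comm]
      exact (mul_le_mul_of_nonneg_right (hv _) (by linarith)).trans_eq (by ring)
    have hmiddle : dist (v (⌊s⌋₊ + 1)) (v ⌊t⌋₊) ≤ C * (⌊t⌋₊ - (⌊s⌋₊ + 1)) := by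
      refine (dist_le_Ico_sum_of_dist_le (f := v) hlt fun _ _ => hv _).trans_eq ?_
      rw [Finset.sum_const, Nat.card_Ico, nsmul_eq_mul, Nat.cast_sub hlt, Nat.cast_succ, mul_comm]
    have hlast : dist (v ⌊t⌋₊) (lineMap (v ⌊t⌋₊) (v (⌊t⌋₊ + 1)) (t - ⌊t⌋₊)) ≤ C * (t - ⌊t⌋₊) := by
      rw [dist_left_lineMap, Real.norm_of_nonneg (by linarith), mul_comm]
      exact mul_le_mul_of_nonneg_right (hv _) (by linarith)
    linarith [dist_triangle4 (lineMap (v ⌊s⌋₊) (v (⌊s⌋₊ + 1)) (s - ⌊s⌋₊)) (v (⌊s⌋₊ + 1)) (v ⌊t⌋₊)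
      (lineMap (v ⌊t⌋₊) (v (⌊t⌋₊ + 1)) (t - ⌊t⌋₊))]

end Interpolation

end BarkingReduction

namespace Polyline

open AffineMap BarkingReduction

theorem point_cons_zero (p : Plane) (l : List Plane) : point (p :: l) 0 = p := by
  cases l with
  | nil => rfl
  | cons q l => rw [point, if_pos dist_nonneg, zero_div, lineMap_apply_zero]

theorem point_cons_cons_of_le {p q : Plane} {l : List Plane} {t : ℝ} (h : dist p q ≤ t) :
    point (p :: q :: l) t = point (q :: l) (t - dist p q) := by
  rw [point]
  split_ifs with hle
  · obtain rfl := le_antisymm hle h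
    rw [sub_self, point_cons_zero]
    rcases eq_or_ne p q with rfl | hpq
    · exact lineMap_same_apply p _
    · rw [div_self (dist_ne_zero.2 hpq), lineMap_apply_one]
  · rfl

theorem dist_point_le {l : List Plane} {s t : ℝ} (hs : 0 ≤ s) (hst : s ≤ t) (ht : t ≤ length l) :
    dist (point l s) (point l t) ≤ t - s := by
  induction l generalizing s t with
  | nil => exact (dist_self (0 : Plane)).trans_le (sub_nonneg.2 hst)
  | cons p l ih =>
    obtain _ | ⟨q, l⟩ := l
    · exact (dist_self p).trans_le (sub_nonneg.2 hst)
    rw [length] at ht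
    have hedge : ∀ {u v}, 0 ≤ u → u ≤ v → v ≤ dist p q →
        dist (point (p :: q :: l) u) (point (p :: q :: l) v) ≤ v - u := fun {u v} _ huv hv => by
      rw [point, if_pos (huv.trans hv), point, if_pos hv, dist_lineMap_lineMap, Real.dist_eq,
        ← sub_div, abs_div, abs_of_nonneg (dist_nonneg (x := p)), abs_sub_comm,
        abs_of_nonneg (sub_nonneg.2 huv), div_mul_eq_mul_div]
      exact div_le_of_le_mul₀ dist_nonneg (sub_nonneg.2 huv) le_rfl
    have hrest : ∀ {u v}, dist p q ≤ u → u ≤ v → v ≤ t →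
        dist (point (p :: q :: l) u) (point (p :: q :: l) v) ≤ v - u := fun {u v} hu huv hv => by
      rw [point_cons_cons_of_le hu, point_cons_cons_of_le (hu.trans huv)]
      exact (ih (by linarith) (by linarith) (by linarith)).trans_eq (by ring)
    rcases le_total t (dist p q) with ht' | ht'
    · exact hedge hs hst ht'
    rcases le_total (dist p q) s with hs' | hs'
    · exact hrest hs' hst le_rfl
    · exact (dist_triangle _ (point (p :: q :: l) (dist p q)) _).trans
        ((add_le_add (hedge hs hs' le_rfl) (hrest le_rfl ht' le_rfl)).trans_eq (by ring))

theorem lipschitzOnWith_point (l : List Plane) :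
    LipschitzOnWith 1 (point l) (Set.Icc 0 (length l)) := by
  refine LipschitzOnWith.of_dist_le_mul fun s hs t ht => ?_
  rw [NNReal.coe_one, one_mul, Real.dist_eq]
  rcases le_total s t with hst | hst
  · rw [abs_sub_comm, abs_of_nonneg (sub_nonneg.2 hst)]
    exact dist_point_le hs.1 hst ht.2
  · rw [dist_comm, abs_of_nonneg (sub_nonneg.2 hst)]
    exact dist_point_le ht.1 hst hs.2

theorem barkingDistance_eq_zero {ρ : ℝ} {s : ℝ≥0} {P Q : List Plane} {γ : ℝ → ℝ}
    (hγ : IsWalk s P Q γ)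
    (hdist : ∀ t ∈ Set.Icc 0 (length P), dist (point P t) (point Q (γ t)) ≤ ρ) :
    barkingDistance ρ s P Q = 0 := by
  refine le_antisymm ((iInf₂_le γ hγ).trans_eq ?_) bot_le
  have hnear : Set.EqOn (fun t => threshold ρ (point P t) (point Q (γ t))) 0
      (Set.Icc 0 (length P)) := fun t ht => if_neg (not_lt.2 (hdist t ht))
  rw [MeasureTheory.setLIntegral_congr_fun measurableSet_Icc hnear]
  exact MeasureTheory.lintegral_zero

theorem IsWalk.lipschitzOnWith_dist {s : ℝ≥0} {P Q : List Plane} {γ : ℝ → ℝ}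
    (hγ : IsWalk s P Q γ) : LipschitzOnWith (1 + s) (fun t => dist (point P t) (point Q (γ t)))
      (Set.Icc 0 (length P)) := by
  have hQ : LipschitzOnWith s (fun t => point Q (γ t)) (Set.Icc 0 (length P)) :=
    one_mul s ▸ (lipschitzOnWith_point Q).comp hγ.speed hγ.mapsTo
  refine LipschitzOnWith.of_dist_le_mul fun a ha b hb => (dist_dist_dist_le _ _ _ _).trans ?_
  rw [NNReal.coe_add, add_mul]
  exact add_le_add ((lipschitzOnWith_point P).dist_le_mul a ha b hb) (hQ.dist_le_mul a ha b hb)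

theorem IsWalk.ofReal_le_lintegral_threshold {ρ e : ℝ} {s : ℝ≥0} {P Q : List Plane} {γ : ℝ → ℝ}
    (hγ : IsWalk s P Q γ) (he : 0 ≤ e) (heP : e ≤ length P / 2) {t : ℝ}
    (ht : t ∈ Set.Icc 0 (length P))
    (hfar : ρ + (1 + s) * e < dist (point P t) (point Q (γ t))) :
    ENNReal.ofReal e ≤ ∫⁻ u in Set.Icc 0 (length P), threshold ρ (point P u) (point Q (γ u)) := by
  obtain ⟨a, ha0, ha1, hat, hta⟩ : ∃ a, 0 ≤ a ∧ a + e ≤ length P ∧ a ≤ t ∧ t ≤ a + e := by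
    rcases le_total t (length P / 2) with h | h
    · exact ⟨t, ht.1, by linarith, le_rfl, by linarith⟩
    · exact ⟨t - e, by linarith, by linarith [ht.2], by linarith, by linarith⟩
  have hsub : Set.Icc a (a + e) ⊆ Set.Icc 0 (length P) := Set.Icc_subset_Icc ha0 ha1
  have hfar' : ∀ u ∈ Set.Icc a (a + e), threshold ρ (point P u) (point Q (γ u)) = 1 :=
    fun u hu => by
      have htu : dist t u ≤ e := abs_sub_le_iff.2 ⟨by linarith [hu.1], by linarith [hu.2]⟩
      have hmul := mul_le_mul_of_nonneg_left htu (1 + s).coe_nonneg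
      have hlip := (le_abs_self _).trans (hγ.lipschitzOnWith_dist.dist_le_mul t ht u (hsub hu))
      rw [NNReal.coe_add, NNReal.coe_one] at hmul hlip
      exact if_pos (by linarith)
  calc ENNReal.ofReal e = ∫⁻ _ in Set.Icc a (a + e), 1 := by
        rw [MeasureTheory.setLIntegral_one, Real.volume_Icc, add_sub_cancel_left]
    _ = ∫⁻ u in Set.Icc a (a + e), threshold ρ (point P u) (point Q (γ u)) :=
        (MeasureTheory.setLIntegral_congr_fun measurableSet_Icc hfar').symm
    _ ≤ _ := MeasureTheory.lintegral_mono_set hsub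

theorem exists_isWalk_of_barkingDistance_eq_zero {ρ r : ℝ} (hr : ρ < r) {s : ℝ≥0}
    {P Q : List Plane} (hP : 0 < length P) (h : barkingDistance ρ s P Q = 0) :
    ∃ γ, IsWalk s P Q γ ∧ ∀ t ∈ Set.Icc 0 (length P), dist (point P t) (point Q (γ t)) ≤ r := by
  have hs : (0 : ℝ) < 1 + s := by positivity
  set e := min (length P / 2) ((r - ρ) / (1 + s))
  have he0 : 0 < e := lt_min (half_pos hP) (div_pos (sub_pos.2 hr) hs)
  have her : (1 + s) * e ≤ r - ρ := (le_div_iff₀' hs).1 (min_le_right _ _)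
  have hlt : barkingDistance ρ s P Q < ENNReal.ofReal e := h ▸ ENNReal.ofReal_pos.2 he0
  obtain ⟨γ, hγ⟩ := iInf_lt_iff.1 hlt
  obtain ⟨hwalk, hγ⟩ := iInf_lt_iff.1 hγ
  refine ⟨γ, hwalk, fun t ht => ?_⟩
  by_contra! hfar
  exact hγ.not_ge (hwalk.ofReal_le_lintegral_threshold he0.le (min_le_left _ _) ht (by linarith))

theorem length_ofFn_of_dist_eq {c : ℝ} (N : ℕ) {v : ℕ → Plane}
    (hv : ∀ i < N, dist (v i) (v (i + 1)) = c) :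
    length (List.ofFn fun i : Fin (N + 1) => v i) = N * c := by
  induction N generalizing v with
  | zero => rw [Nat.cast_zero, zero_mul, List.ofFn_succ, List.ofFn_zero, length]
  | succ N ih =>
    have hrest := ih (v := fun i => v (i + 1)) fun i hi => hv (i + 1) (Nat.succ_lt_succ hi)
    rw [List.ofFn_succ] at hrest ⊢
    rw [List.ofFn_succ]
    refine (congrArg₂ (· + ·) (hv 0 N.succ_pos) hrest).trans ?_
    rw [Nat.cast_succ]
    ring

theorem point_ofFn_of_dist_eq {c : ℝ} (hc : 0 < c) (N : ℕ) {v : ℕ → Plane}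
    (hv : ∀ i < N, dist (v i) (v (i + 1)) = c) {t : ℝ} (h0 : 0 ≤ t) (h1 : t ≤ N * c) :
    point (List.ofFn fun i : Fin (N + 1) => v i) t = interpolate v (t / c) := by
  induction N generalizing v t with
  | zero =>
    obtain rfl : t = 0 := le_antisymm (by simpa using h1) h0
    rw [List.ofFn_succ, point_cons_zero, zero_div, interpolate_zero]
    rfl
  | succ N ih =>
    have hv0 := hv 0 N.succ_pos
    rcases le_total t c with htc | htc
    · have hedge : point (List.ofFn fun i : Fin (N + 1 + 1) => v i) t =
          lineMap (v 0) (v 1) (t / c) := by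
        rw [List.ofFn_succ, List.ofFn_succ, ← hv0]
        exact if_pos (htc.trans_eq hv0.symm)
      rw [hedge]
      simpa using (interpolate_natCast_add v 0 (div_nonneg h0 hc.le) ((div_le_one hc).2 htc)).symm
    · have hrest := ih (v := fun i => v (i + 1)) (fun i hi => hv (i + 1) (Nat.succ_lt_succ hi))
        (sub_nonneg.2 htc) (by rw [Nat.cast_succ] at h1; linarith)
      have hpoint : point (List.ofFn fun i : Fin (N + 1 + 1) => v i) t =
          point (List.ofFn fun i : Fin (N + 1) => v (i + 1)) (t - c) := by
        rw [List.ofFn_succ, List.ofFn_succ, ← hv0]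
        exact (point_cons_cons_of_le (hv0.trans_le htc)).trans (by rw [List.ofFn_succ]; rfl)
      rw [hpoint, hrest, ← interpolate_add_one v (div_nonneg (sub_nonneg.2 htc) hc.le), sub_div,
        div_self hc.ne', sub_add_cancel]

end Polyline

/-! ### Zigzag polylines -/

namespace BarkingReduction

open AffineMap

/-- The vertices of a polyline with horizontal coordinates `x` that ascends by `q` along every
edge. -/
noncomputable def slopedVertex (x : ℕ → ℝ) (q : ℝ) (k : ℕ) : Plane := !₂[x k, q * (k + 1)]

/-- The polyline with `N` edges and the vertices `slopedVertex x q`. -/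
noncomputable def slopedPolyline (x : ℕ → ℝ) (q : ℝ) (N : ℕ) : List Plane :=
  List.ofFn fun k : Fin (N + 1) => slopedVertex x q k

section SlopedPolyline

variable {x : ℕ → ℝ} {δ q : ℝ} {N : ℕ}

theorem dist_slopedVertex (hx : ∀ k, dist (x k) (x (k + 1)) = δ) (k : ℕ) :
    dist (slopedVertex x q k) (slopedVertex x q (k + 1)) = √(δ ^ 2 + q ^ 2) := by
  rw [EuclideanSpace.dist_eq, Fin.sum_univ_two]
  congr 2
  · exact congrArg (· ^ 2) (hx k)
  · change dist (q * (k + 1)) (q * ((k + 1 : ℕ) + 1)) ^ 2 = q ^ 2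
    rw [Real.dist_eq, sq_abs, Nat.cast_succ]
    ring

theorem interpolate_slopedVertex {t : ℝ} (ht : 0 ≤ t) :
    interpolate (slopedVertex x q) t = !₂[interpolate x t, q * (t + 1)] := by
  obtain ⟨k, θ, h0, h1, rfl⟩ := exists_eq_natCast_add ht
  rw [interpolate_natCast_add _ k h0 h1, interpolate_natCast_add _ k h0 h1]
  ext i
  fin_cases i <;> simp [slopedVertex, lineMap_apply]
  ring

theorem length_slopedPolyline (hx : ∀ k, dist (x k) (x (k + 1)) = δ) :
    Polyline.length (slopedPolyline x q N) = N * √(δ ^ 2 + q ^ 2) :=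
  Polyline.length_ofFn_of_dist_eq N fun k _ => dist_slopedVertex hx k

theorem point_slopedPolyline (hx : ∀ k, dist (x k) (x (k + 1)) = δ) (hq : q ≠ 0) {t : ℝ}
    (ht : t ∈ Set.Icc 0 (Polyline.length (slopedPolyline x q N))) :
    Polyline.point (slopedPolyline x q N) t =
      !₂[interpolate x (t / √(δ ^ 2 + q ^ 2)), q * (t / √(δ ^ 2 + q ^ 2) + 1)] := by
  have hc : 0 < √(δ ^ 2 + q ^ 2) := by positivity
  rw [length_slopedPolyline hx] at ht
  rw [← interpolate_slopedVertex (div_nonneg ht.1 hc.le)]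
  exact Polyline.point_ofFn_of_dist_eq hc N (fun k _ => dist_slopedVertex hx k) ht.1 ht.2

theorem point_slopedPolyline_one (hx : ∀ k, dist (x k) (x (k + 1)) = δ) (hq : q ≠ 0) {t : ℝ}
    (ht : t ∈ Set.Icc 0 (Polyline.length (slopedPolyline x q N))) :
    Polyline.point (slopedPolyline x q N) t 1 = q * (t / √(δ ^ 2 + q ^ 2) + 1) := by
  rw [point_slopedPolyline hx hq ht]
  rfl

theorem isSimple_slopedPolyline (hx : ∀ k, dist (x k) (x (k + 1)) = δ) (hq : q ≠ 0) :
    Polyline.IsSimple (slopedPolyline x q N) := by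
  refine ⟨List.nodup_ofFn.2 fun i j hij => ?_, fun s hs t ht hst => ?_⟩
  · have hij' : q * ((i : ℕ) + 1) = q * ((j : ℕ) + 1) := congrArg (fun p : Plane => p 1) hij
    exact Fin.ext (Nat.cast_injective (add_right_cancel (mul_left_cancel₀ hq hij')))
  · have hst' := congrArg (fun p : Plane => p 1) hst
    simp only [point_slopedPolyline_one hx hq hs, point_slopedPolyline_one hx hq ht] at hst'
    have hc : √(δ ^ 2 + q ^ 2) ≠ 0 := by positivity
    exact (div_left_inj' hc).1 (add_right_cancel (mul_left_cancel₀ hq hst'))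

theorem disjoint_carrier_slopedPolyline {x' : ℕ → ℝ} {δ' q' : ℝ} {N' : ℕ}
    (hx : ∀ k, dist (x k) (x (k + 1)) = δ) (hx' : ∀ k, dist (x' k) (x' (k + 1)) = δ')
    (hq : 0 < q) (hq' : q' < 0) :
    Disjoint (Polyline.carrier (slopedPolyline x q N))
      (Polyline.carrier (slopedPolyline x' q' N')) := by
  rw [Set.disjoint_left]
  rintro _ ⟨s, hs, rfl⟩ ⟨t, ht, hst⟩
  have hst' := congrArg (fun p : Plane => p 1) hst
  simp only [point_slopedPolyline_one hx hq.ne' hs, point_slopedPolyline_one hx' hq'.ne ht] at hst'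
  have hs0 : 0 < s / √(δ ^ 2 + q ^ 2) + 1 := add_pos_of_nonneg_of_pos
    (div_nonneg hs.1 (Real.sqrt_nonneg _)) one_pos
  have ht0 : 0 < t / √(δ' ^ 2 + q' ^ 2) + 1 := add_pos_of_nonneg_of_pos
    (div_nonneg ht.1 (Real.sqrt_nonneg _)) one_pos
  exact ((mul_neg_of_neg_of_pos hq' ht0).trans (mul_pos hq hs0)).ne hst'

end SlopedPolyline

/-- The hiker's polyline in a scale `u`: its vertices are at the horizontal positions `H k`. -/
noncomputable def hikerLine (u q : ℝ) (H : ℕ → ℝ) (M : ℕ) : List Plane :=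
  slopedPolyline (fun k => u * H k) q (4 * M)

/-- The dog's polyline in a scale `u`: horizontally it passes the positions `D m + 3`. Its edges are
subdivided into four, so that it has as many edges as the hiker's polyline but a quarter of the
length. -/
noncomputable def dogLine (u q : ℝ) (D : ℕ → ℝ) (M : ℕ) : List Plane :=
  slopedPolyline (fun i => u * (interpolate D (i / 4) + 3)) (-(q / 4)) (4 * M)

section Zigzag

variable {u q : ℝ} {H D : ℕ → ℝ} {M : ℕ}

theorem dist_hikerLine_step (hu : 0 < u) (hH : ∀ k, dist (H k) (H (k + 1)) = 1) (k : ℕ) :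
    dist (u * H k) (u * H (k + 1)) = u := by
  rw [Real.dist_eq, ← mul_sub, abs_mul, ← Real.dist_eq, hH, abs_of_pos hu, mul_one]

theorem dist_dogLine_step (hu : 0 < u) (hD : ∀ k, dist (D k) (D (k + 1)) = 1) (i : ℕ) :
    dist (u * (interpolate D ((i : ℝ) / 4) + 3)) (u * (interpolate D ((i + 1 : ℕ) / 4) + 3)) =
      u / 4 := by
  have hquarter : dist (interpolate D ((i : ℝ) / 4)) (interpolate D ((i + 1 : ℕ) / 4)) = 1 / 4 := by
    have h0 := interpolate_natCast_add_div D (c := 4) (by norm_num) i le_rfl zero_le_one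
    have h1 := interpolate_natCast_add_div D (c := 4) (by norm_num) i zero_le_one le_rfl
    rw [add_zero, Nat.cast_ofNat] at h0
    rw [Nat.cast_ofNat, ← Nat.cast_succ i] at h1
    rw [h0, h1, dist_lineMap_lineMap, hD, mul_one, Real.dist_eq, abs_sub_comm,
      show ∀ r : ℝ, (r + 1) / 4 - (r + 0) / 4 = 1 / 4 from fun r => by ring]
    norm_num
  rw [Real.dist_eq, ← mul_sub, add_sub_add_right_eq_sub, abs_mul, ← Real.dist_eq, hquarter,
    abs_of_pos hu, mul_one_div]

/-- The length of the edges of the hiker's polyline. -/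
noncomputable def edgeLength (u q : ℝ) : ℝ := √(u ^ 2 + q ^ 2)

theorem edgeLength_pos (hu : 0 < u) : 0 < edgeLength u q := by
  unfold edgeLength
  positivity

theorem sqrt_quarter_eq : √((u / 4) ^ 2 + (-(q / 4)) ^ 2) = edgeLength u q / 4 := by
  rw [edgeLength, show (u / 4) ^ 2 + (-(q / 4)) ^ 2 = (u ^ 2 + q ^ 2) / 4 ^ 2 by ring,
    Real.sqrt_div' _ (by positivity), Real.sqrt_sq (by norm_num)]

theorem length_hikerLine (hu : 0 < u) (hH : ∀ k, dist (H k) (H (k + 1)) = 1) :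
    Polyline.length (hikerLine u q H M) = (4 * M : ℕ) * edgeLength u q :=
  length_slopedPolyline (dist_hikerLine_step hu hH)

theorem length_dogLine (hu : 0 < u) (hD : ∀ k, dist (D k) (D (k + 1)) = 1) :
    Polyline.length (dogLine u q D M) = M * edgeLength u q := by
  rw [dogLine, length_slopedPolyline (dist_dogLine_step hu hD), sqrt_quarter_eq, Nat.cast_mul,
    Nat.cast_ofNat]
  ring

theorem point_hikerLine (hu : 0 < u) (hq : 0 < q) (hH : ∀ k, dist (H k) (H (k + 1)) = 1) {t : ℝ}
    (h0 : 0 ≤ t) (h1 : t ≤ (4 * M : ℕ)) :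
    Polyline.point (hikerLine u q H M) (t * edgeLength u q) =
      !₂[u * interpolate H t, q * (t + 1)] := by
  have hl := edgeLength_pos (q := q) hu
  have ht : t * edgeLength u q ∈ Set.Icc 0 (Polyline.length (hikerLine u q H M)) := by
    rw [length_hikerLine hu hH]
    exact ⟨by positivity, by gcongr⟩
  rw [hikerLine, point_slopedPolyline (dist_hikerLine_step hu hH) hq.ne' ht, ← edgeLength,
    mul_div_cancel_right₀ _ hl.ne']
  exact congrArg (!₂[·, q * (t + 1)]) (interpolate_const_smul u H t)

theorem point_dogLine (hu : 0 < u) (hq : 0 < q) (hD : ∀ k, dist (D k) (D (k + 1)) = 1) {t : ℝ}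
    (h0 : 0 ≤ t) (h1 : t ≤ M) :
    Polyline.point (dogLine u q D M) (t * edgeLength u q) =
      !₂[u * (interpolate D t + 3), -(q / 4) * (4 * t + 1)] := by
  have hl := edgeLength_pos (q := q) hu
  have ht : t * edgeLength u q ∈ Set.Icc 0 (Polyline.length (dogLine u q D M)) := by
    rw [length_dogLine hu hD]
    exact ⟨by positivity, by gcongr⟩
  have hquarter : t * edgeLength u q / (edgeLength u q / 4) = 4 * t := by
    field_simp
  rw [dogLine, point_slopedPolyline (dist_dogLine_step hu hD) (by linarith) ht, sqrt_quarter_eq,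
    hquarter]
  congr 2
  have hsub := interpolate_subdivide D (c := 4) (by norm_num) (t := 4 * t) (by positivity)
  rw [Nat.cast_ofNat, mul_div_cancel_left₀ t four_ne_zero] at hsub
  rw [← hsub, ← interpolate_add_const]
  exact interpolate_const_smul u _ _

/-- Looking only at the horizontal distance at the vertices of the hiker, one gets the positions
of the dog on its polyline at these times, in units of the edges of the hiker. -/
theorem exists_positions_of_barkingDistance_eq_zero (hu : 0 < u) (hq : 0 < q) (hM : 0 < M)
    (hH : ∀ k, dist (H k) (H (k + 1)) = 1) (hD : ∀ k, dist (D k) (D (k + 1)) = 1) {ρ r : ℝ}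
    (hr : ρ < u * r)
    (h : Polyline.barkingDistance ρ 1 (hikerLine u q H M) (dogLine u q D M) = 0) :
    ∃ s : ℕ → ℝ, (∀ k ≤ 4 * M, s k ∈ Set.Icc 0 (M : ℝ)) ∧
      (∀ k < 4 * M, |s (k + 1) - s k| ≤ 1) ∧
      ∀ k ≤ 4 * M, |H k - (interpolate D (s k) + 3)| ≤ r := by
  set l := edgeLength u q
  have hl : 0 < l := edgeLength_pos hu
  obtain ⟨γ, hγ, hdist⟩ := Polyline.exists_isWalk_of_barkingDistance_eq_zero hr
    (by rw [length_hikerLine hu hH]; positivity) h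
  have htime : ∀ k ≤ 4 * M, k * l ∈ Set.Icc 0 (Polyline.length (hikerLine u q H M)) :=
    fun k hk => by
      rw [length_hikerLine hu hH]
      exact ⟨by positivity, mul_le_mul_of_nonneg_right (Nat.cast_le.2 hk) hl.le⟩
  have hpos : ∀ k ≤ 4 * M, γ (k * l) / l ∈ Set.Icc 0 (M : ℝ) := fun k hk => by
    have hmem := hγ.mapsTo (htime k hk)
    rw [length_dogLine hu hD] at hmem
    exact ⟨div_nonneg hmem.1 hl.le, (div_le_iff₀ hl).2 hmem.2⟩
  refine ⟨fun k => γ (k * l) / l, hpos, fun k hk => ?_, fun k hk => ?_⟩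
  · have hspeed := hγ.speed.dist_le_mul _ (htime (k + 1) hk) _ (htime k hk.le)
    rw [Real.dist_eq, Real.dist_eq, NNReal.coe_one, one_mul, ← sub_mul, Nat.cast_succ,
      add_sub_cancel_left, one_mul, abs_of_pos hl] at hspeed
    rwa [← sub_div, abs_div, abs_of_pos hl, div_le_one hl, Nat.cast_succ]
  · have hx := (PiLp.dist_apply_le _ _ 0).trans (hdist _ (htime k hk))
    rw [← div_mul_cancel₀ (γ (k * l)) hl.ne', point_dogLine hu hq hD (hpos k hk).1 (hpos k hk).2,
      point_hikerLine hu hq hH (Nat.cast_nonneg k) (Nat.cast_le.2 hk), interpolate_natCast] at hx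
    change dist (u * H k) (u * (interpolate D _ + 3)) ≤ u * r at hx
    rw [Real.dist_eq, ← mul_sub, abs_mul, abs_of_pos hu] at hx
    exact le_of_mul_le_mul_left hx hu

theorem interpolate_comp {v : ℕ → ℝ} {y : ℕ → ℕ} (hy : ∀ k, y (k + 1) = y k ∨ y (k + 1) = y k + 1)
    {t : ℝ} (ht : 0 ≤ t) :
    interpolate v (interpolate (fun k => (y k : ℝ)) t) = interpolate (fun k => v (y k)) t := by
  obtain ⟨k, θ, h0, h1, rfl⟩ := exists_eq_natCast_add ht
  rw [interpolate_natCast_add _ _ h0 h1, interpolate_natCast_add _ _ h0 h1]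
  rcases hy k with h | h
  · rw [h, lineMap_same, lineMap_same, const_apply, const_apply, interpolate_natCast]
  · rw [h, Nat.cast_succ, lineMap_apply_ring', add_sub_cancel_left, mul_one, add_comm,
      interpolate_natCast_add _ _ h0 h1]

theorem isWalk_interpolate (hu : 0 < u) (hH : ∀ k, dist (H k) (H (k + 1)) = 1)
    (hD : ∀ k, dist (D k) (D (k + 1)) = 1) {y : ℕ → ℕ}
    (hy : ∀ k, y (k + 1) = y k ∨ y (k + 1) = y k + 1) (hyM : ∀ k, y k ≤ M) (h0 : y 0 = 0)
    (hM : y (4 * M) = M) :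
    Polyline.IsWalk 1 (hikerLine u q H M) (dogLine u q D M)
      (fun t => interpolate (fun k => (y k : ℝ)) (t / edgeLength u q) * edgeLength u q) := by
  have hl := edgeLength_pos (q := q) hu
  have hunit : ∀ k, dist (y k : ℝ) (y (k + 1)) ≤ 1 := fun k => by
    rcases hy k with h | h <;> rw [h] <;> simp
  refine ⟨fun t ht => ?_, ?_, ?_, LipschitzOnWith.of_dist_le_mul fun s hs t ht => ?_⟩
  · rw [length_dogLine hu hD]
    have hmem := interpolate_mem_of_convex (convex_Icc 0 (M : ℝ)) (v := fun k => (y k : ℝ))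
      (fun k => ⟨Nat.cast_nonneg _, Nat.cast_le.2 (hyM k)⟩) (div_nonneg ht.1 hl.le)
    exact ⟨mul_nonneg hmem.1 hl.le, mul_le_mul_of_nonneg_right hmem.2 hl.le⟩
  · rw [zero_div, interpolate_zero, h0, Nat.cast_zero, zero_mul]
  · rw [length_hikerLine hu hH, length_dogLine hu hD, mul_div_cancel_right₀ _ hl.ne',
      interpolate_natCast, hM]
  · have hlip := dist_interpolate_le hunit (div_nonneg hs.1 hl.le) (div_nonneg ht.1 hl.le)
    rw [one_mul, Real.dist_eq, Real.dist_eq, ← sub_div, abs_div, abs_of_pos hl,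
      le_div_iff₀ hl] at hlip
    rwa [Real.dist_eq, ← sub_mul, abs_mul, abs_of_pos hl, NNReal.coe_one, one_mul, Real.dist_eq]

theorem barkingDistance_eq_zero_of_positions (hu : 0 < u) (hq : 0 < q)
    (hH : ∀ k, dist (H k) (H (k + 1)) = 1) (hD : ∀ k, dist (D k) (D (k + 1)) = 1) {y : ℕ → ℕ}
    (hy : ∀ k, y (k + 1) = y k ∨ y (k + 1) = y k + 1) (hyM : ∀ k, y k ≤ M) (h0 : y 0 = 0)
    (hM : y (4 * M) = M) {ρ r : ℝ} (hρ : 0 ≤ ρ) (hr : ∀ k, dist (H k) (D (y k) + 3) ≤ r)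
    (hrρ : (u * r) ^ 2 + (q * (5 * M + 5 / 4)) ^ 2 ≤ ρ ^ 2) :
    Polyline.barkingDistance ρ 1 (hikerLine u q H M) (dogLine u q D M) = 0 := by
  have hl := edgeLength_pos (q := q) hu
  have hwalk := isWalk_interpolate (q := q) hu hH hD hy hyM h0 hM
  refine Polyline.barkingDistance_eq_zero hwalk fun t ht => ?_
  have hdog := hwalk.mapsTo ht
  rw [length_hikerLine hu hH] at ht
  rw [length_dogLine hu hD] at hdog
  obtain ⟨τ, rfl⟩ : ∃ τ, t = τ * edgeLength u q := ⟨_, (div_mul_cancel₀ t hl.ne').symm⟩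
  simp only [mul_div_cancel_right₀ _ hl.ne'] at hdog ⊢
  have hτ0 := nonneg_of_mul_nonneg_left ht.1 hl
  have hτ1 := le_of_mul_le_mul_right ht.2 hl
  have hd0 := nonneg_of_mul_nonneg_left hdog.1 hl
  have hd1 := le_of_mul_le_mul_right hdog.2 hl
  rw [point_hikerLine hu hq hH hτ0 hτ1, point_dogLine hu hq hD hd0 hd1, interpolate_comp hy hτ0,
    ← interpolate_add_const, EuclideanSpace.dist_eq, Fin.sum_univ_two]
  refine Real.sqrt_le_iff.2 ⟨hρ, le_trans (add_le_add ?_ ?_) hrρ⟩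
  · refine pow_le_pow_left₀ dist_nonneg ?_ 2
    change dist (u * interpolate H τ) (u * interpolate (fun k => D (y k) + 3) τ) ≤ u * r
    rw [Real.dist_eq, ← mul_sub, abs_mul, abs_of_pos hu]
    exact mul_le_mul_of_nonneg_left (dist_interpolate_interpolate_le hr hτ0) hu.le
  · refine pow_le_pow_left₀ dist_nonneg ?_ 2
    set f := interpolate (fun k => (y k : ℝ)) τ
    change dist (q * (τ + 1)) (-(q / 4) * (4 * f + 1)) ≤ _
    rw [Nat.cast_mul, Nat.cast_ofNat] at hτ1
    rw [Real.dist_eq, show q * (τ + 1) - -(q / 4) * (4 * f + 1) = q * (τ + f + 5 / 4) by ring,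
      abs_of_nonneg (by positivity)]
    exact mul_le_mul_of_nonneg_left (by linarith) hq.le

end Zigzag

end BarkingReduction

/-! ### Orthogonality and barking distances -/

namespace BarkingReduction

/-- The integer of the parity of `k + 1` in the interval `(x - 1, x + 1]`, to which the position `x`
of the dog at time `k` is rounded. -/
noncomputable def parityRound (k : ℕ) (x : ℝ) : ℤ := k + 1 + 2 * ⌊(x - k) / 2⌋

section ParityRound

variable (k : ℕ) {x x' : ℝ}

theorem parityRound_le (x : ℝ) : parityRound k x ≤ x + 1 := by
  have := Int.floor_le ((x - k) / 2)
  unfold parityRound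
  push_cast
  linarith

theorem sub_one_lt_parityRound (x : ℝ) : x - 1 < parityRound k x := by
  have := Int.lt_floor_add_one ((x - k) / 2)
  unfold parityRound
  push_cast
  linarith

theorem parityRound_nonneg (hx : 0 ≤ x) : 0 ≤ parityRound k x := by
  have hlt : ((-1 : ℤ) : ℝ) < parityRound k x := by
    push_cast
    linarith [sub_one_lt_parityRound k x]
  have := Int.cast_lt.1 hlt
  omega

theorem parityRound_succ_eq (h : |x' - x| ≤ 1) :
    parityRound (k + 1) x' = parityRound k x + 1 ∨
      parityRound (k + 1) x' = parityRound k x - 1 := by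
  have hx := abs_le.1 h
  have hle : ⌊(x' - (k + 1 : ℕ)) / 2⌋ ≤ ⌊(x - k) / 2⌋ :=
    Int.floor_mono (by push_cast; linarith)
  have hge : ⌊(x - k) / 2⌋ - 1 ≤ ⌊(x' - (k + 1 : ℕ)) / 2⌋ := by
    rw [← Int.floor_sub_one]
    exact Int.floor_mono (by push_cast; linarith)
  unfold parityRound
  push_cast at hle hge ⊢
  omega

end ParityRound

theorem UnitSteps.dist_eq_one {u : ℕ → ℕ} (hu : UnitSteps u) (k : ℕ) :
    dist (u k : ℝ) (u (k + 1)) = 1 := by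
  rcases hu k with h | h <;> rw [h] <;> simp

section Discretization

variable {n d T M : ℕ} {α β : ℕ → ℕ → Bool}

/-- The dog's level at a vertex is an integer of the parity of the hiker's level, so a deviation of
`9 / 2` from the middle of the range is as good as one of `3`. -/
theorem inRange_of_abs_sub_le {k m : ℕ} (hm : m % 2 = (k + 1) % 2) {x : ℝ} (hx : 0 ≤ x)
    (hxm : |x - m| ≤ 1)
    (h : |(hikerLevel n d α k : ℝ) - (interpolate (fun m => (dogLevel d β m : ℝ)) x + 3)| ≤ 7 / 2) :
    InRange n d α β k m := by
  have hlip := dist_interpolate_le (fun k => (unitSteps_dogLevel.dist_eq_one k).le)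
    hx m.cast_nonneg (v := fun m => (dogLevel d β m : ℝ))
  rw [interpolate_natCast, one_mul, Real.dist_eq, Real.dist_eq] at hlip
  have hx' := abs_le.1 (hlip.trans hxm)
  have h' := abs_le.1 h
  have hhigh : (hikerLevel n d α k : ℝ) < (dogLevel d β m + 8 : ℕ) := by push_cast; linarith
  have hlow : (dogLevel d β m : ℝ) < (hikerLevel n d α k + 2 : ℕ) := by push_cast; linarith
  have := Nat.cast_lt.1 hhigh
  have := Nat.cast_lt.1 hlow
  have := hikerLevel_mod_two (n := n) (d := d) (α := α) k
  have := dogLevel_mod_two (d := d) (β := β) m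
  unfold InRange
  omega

theorem exists_isDiscreteWalk {s : ℕ → ℝ} (hs : ∀ k ≤ T, s k ∈ Set.Icc 0 (M : ℝ))
    (hstep : ∀ k < T, |s (k + 1) - s k| ≤ 1)
    (hr : ∀ k ≤ T, |(hikerLevel n d α k : ℝ) -
      (interpolate (fun m => (dogLevel d β m : ℝ)) (s k) + 3)| ≤ 7 / 2) :
    ∃ y, IsDiscreteWalk n d α β T y ∧ ∀ k ≤ T, y k ≤ M + 1 := by
  have hnat : ∀ k ≤ T, ((parityRound k (s k)).toNat : ℤ) = parityRound k (s k) :=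
    fun k hk => Int.toNat_of_nonneg (parityRound_nonneg k (hs k hk).1)
  have hreal : ∀ k ≤ T, ((parityRound k (s k)).toNat : ℝ) = parityRound k (s k) :=
    fun k hk => by exact_mod_cast hnat k hk
  refine ⟨fun k => (parityRound k (s k)).toNat, ⟨fun k hk => ?_, fun k hk => ?_⟩, fun k hk => ?_⟩
  · have := hnat k hk.le
    have := hnat (k + 1) hk
    have := parityRound_succ_eq k (hstep k hk)
    omega
  · refine inRange_of_abs_sub_le ?_ (hs k hk).1 ?_ (hr k hk)
    · have := hnat k hk
      unfold parityRound at this ⊢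
      omega
    · rw [hreal k hk, abs_le]
      have := parityRound_le k (s k)
      have := sub_one_lt_parityRound k (s k)
      constructor <;> linarith
  · have hle := (parityRound_le k (s k)).trans (add_le_add_left (hs k hk).2 1)
    rw [← hreal k hk] at hle
    exact_mod_cast hle

end Discretization

/-- The number of edges of both polylines. -/
def edges (n d : ℕ) : ℕ := 4 * blockStart d n

/-- The rise per edge of the hiker's polyline, such that both polylines stay within height `u / 2`
of the axis. -/
noncomputable def rise (u : ℝ) (n d : ℕ) : ℝ := u / (2 * (edges n d + 1))

section Reduction

variable {n d : ℕ} {α β : ℕ → ℕ → Bool} {ρ u q : ℝ}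

theorem blockStart_pos (hn : 1 ≤ n) : 0 < blockStart d n :=
  blockStart_zero.symm.trans_lt (blockStart_lt_iff.2 hn)

theorem hasOrthogonalPair_of_barkingDistance_eq_zero (hd : 2 ≤ d) (hn : 1 ≤ n) (hu : 0 < u)
    (hq : 0 < q) (hρ : ρ < 7 / 2 * u)
    (h : Polyline.barkingDistance ρ 1 (hikerLine u q (fun k => hikerLevel n d α k) (blockStart d n))
      (dogLine u q (fun m => dogLevel d β m) (blockStart d n)) = 0) :
    HasOrthogonalPair n d α β := by
  obtain ⟨s, hs, hstep, hr⟩ := exists_positions_of_barkingDistance_eq_zero hu hq (blockStart_pos hn)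
    unitSteps_hikerLevel.dist_eq_one unitSteps_dogLevel.dist_eq_one
    (hρ.trans_eq (mul_comm _ u)) h
  obtain ⟨y, hy, hlen⟩ := exists_isDiscreteWalk hs hstep hr
  exact hy.hasOrthogonalPair hd (by have := slot_add_blockStart_le (d := d) hn; omega) hlen

theorem rise_pos (hu : 0 < u) : 0 < rise u n d := by
  unfold rise
  positivity

theorem dogWalk_le {i j : ℕ} (hi : i < n) (hj : j < n) (k : ℕ) :
    dogWalk n d i j k ≤ blockStart d n := by
  have hmono : Monotone (dogWalk n d i j) := monotone_nat_of_le_succ fun k => by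
    have := dogWalk_succ (d := d) hi hj k
    omega
  exact (hmono (le_max_left k _)).trans (dogWalk_of_le hi hj (le_max_right _ _)).le

/-- A dog in range deviates by at most `3 * u` horizontally and, as the polylines rise to `u / 2`
and descend to `-u / 8`, by at most `5 / 8 * u` vertically. -/
theorem barkingDistance_eq_zero_of_hasOrthogonalPair (hn : 1 ≤ n) (hu : 0 < u)
    (hρ : 13 / 4 * u ≤ ρ) (h : HasOrthogonalPair n d α β) :
    Polyline.barkingDistance ρ 1
      (hikerLine u (rise u n d) (fun k => hikerLevel n d α k) (blockStart d n))
      (dogLine u (rise u n d) (fun m => dogLevel d β m) (blockStart d n)) = 0 := by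
  obtain ⟨i, hi, j, hj, hij⟩ := h
  have hheight : rise u n d * (5 * (blockStart d n : ℝ) + 5 / 4) = 5 / 8 * u := by
    rw [rise, edges]
    push_cast
    field
  refine barkingDistance_eq_zero_of_positions (r := 3) hu (rise_pos hu)
    unitSteps_hikerLevel.dist_eq_one unitSteps_dogLevel.dist_eq_one (dogWalk_succ hi hj)
    (dogWalk_le hi hj) dogWalk_zero (dogWalk_of_le hi hj (slot_add_blockStart_le hn))
    (by linarith) (fun k => ?_) ?_
  · obtain ⟨hlow, hhigh⟩ := inRange_dogWalk hi hj hij k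
    have hlow := Nat.cast_le (α := ℝ).2 hlow
    have hhigh := Nat.cast_le (α := ℝ).2 hhigh
    rw [Nat.cast_add, Nat.cast_ofNat] at hhigh
    exact abs_le.2 ⟨by linarith, by linarith⟩
  · calc (u * 3) ^ 2 + (rise u n d * (5 * blockStart d n + 5 / 4)) ^ 2
        = (u * 3) ^ 2 + (5 / 8 * u) ^ 2 := by rw [hheight]
      _ ≤ (13 / 4 * u) ^ 2 := by nlinarith [sq_nonneg u]
      _ ≤ ρ ^ 2 := pow_le_pow_left₀ (by positivity) hρ 2

end Reduction

section Vertices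

variable {n d a b : ℕ} {α β : ℕ → ℕ → Bool}

/-- The vertices of the hiker's polyline, for the horizontal unit `a / b`. -/
def hikerPoint (a b : ℕ) (hb : 0 < b) (n d : ℕ) (α : ℕ → ℕ → Bool) (k : ℕ) : RatPoint where
  x := (a * 8 * (edges n d + 1) * hikerLevel n d α k : ℕ)
  y := (a * 4 * (k + 1) : ℕ)
  den := b * 8 * (edges n d + 1)
  den_pos := by positivity

/-- The levels of the dog's polyline after the subdivision of its edges, in quarters. -/
def dogQuarter (d : ℕ) (β : ℕ → ℕ → Bool) (i : ℕ) : ℕ :=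
  (4 - i % 4) * dogLevel d β (i / 4) + i % 4 * dogLevel d β (i / 4 + 1)

/-- The vertices of the dog's polyline, for the horizontal unit `a / b`. -/
def dogPoint (a b : ℕ) (hb : 0 < b) (n d : ℕ) (β : ℕ → ℕ → Bool) (i : ℕ) : RatPoint where
  x := (a * 2 * (edges n d + 1) * (dogQuarter d β i + 12) : ℕ)
  y := -(a * (i + 1) : ℕ)
  den := b * 8 * (edges n d + 1)
  den_pos := by positivity

theorem dogQuarter_eq (i : ℕ) :
    (dogQuarter d β i : ℝ) = 4 * interpolate (fun m => (dogLevel d β m : ℝ)) (i / 4) := by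
  have hinterpolate := interpolate_natCast_add_div (fun m => (dogLevel d β m : ℝ))
    (c := 4) (θ := 0) (by norm_num) i le_rfl zero_le_one
  rw [add_zero, add_zero, Nat.cast_ofNat] at hinterpolate
  rw [hinterpolate, AffineMap.lineMap_apply_ring, dogQuarter]
  push_cast [Nat.cast_sub (Nat.mod_lt i four_pos).le]
  ring

theorem ratPolyline_hikerPoint (hb : 0 < b) :
    ratPolyline (fun k : Fin (edges n d + 1) => hikerPoint a b hb n d α k) =
      hikerLine (a / b) (rise (a / b) n d) (fun k => hikerLevel n d α k) (blockStart d n) := by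
  refine congrArg List.ofFn (funext fun k => ?_)
  have hb' : (b : ℝ) ≠ 0 := Nat.cast_ne_zero.2 hb.ne'
  unfold RatPoint.toPlane hikerPoint slopedVertex rise
  push_cast
  congr 2
  · field
  · congr 1
    field

theorem ratPolyline_dogPoint (hb : 0 < b) :
    ratPolyline (fun i : Fin (edges n d + 1) => dogPoint a b hb n d β i) =
      dogLine (a / b) (rise (a / b) n d) (fun m => dogLevel d β m) (blockStart d n) := by
  refine congrArg List.ofFn (funext fun i => ?_)
  have hb' : (b : ℝ) ≠ 0 := Nat.cast_ne_zero.2 hb.ne'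
  unfold RatPoint.toPlane dogPoint slopedVertex rise
  push_cast
  rw [dogQuarter_eq]
  congr 2
  · field
  · congr 1
    field

end Vertices

end BarkingReduction

/-! ### Expressions on the word RAM -/

namespace WordRAM

/-- Expressions for the word RAM: they refer to an input array and to an index. -/
inductive Expr where
  | lit (k : ℕ)
  | index
  | input (e : Expr)
  | bin (o : BinOp) (e f : Expr)
  | ite (c e f : Expr)

namespace Expr

/-- The value of an expression for the input array `x` and the index `i`, in `w`-bit arithmetic. -/
def val (w : ℕ) (x : ℕ → ℕ) (i : ℕ) : Expr → ℕ
  | lit k => k % 2 ^ w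
  | index => i
  | input e => x (e.val w x i)
  | bin o e f => o.eval w (e.val w x i) (f.val w x i)
  | ite c e f => if c.val w x i = 0 then f.val w x i else e.val w x i

/-- The number of registers needed to evaluate an expression. -/
def width : Expr → ℕ
  | lit _ => 1
  | index => 1
  | input e => e.width
  | bin _ e f => max e.width (f.width + 1)
  | ite c e f => max c.width (max e.width f.width)

/-- A bound for the time in which `code` evaluates an expression. -/
def cost : Expr → ℕ
  | lit _ => 1
  | index => 1
  | input e => e.cost + 1
  | bin _ e f => e.cost + f.cost + 1
  | ite c e f => c.cost + (max e.cost f.cost + 1)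

/-- A program that puts the value of an expression into register `r`. The input array is array `0`
and the index is in register `0`. -/
def code : Expr → ℕ → Prog
  | lit k, r => .const r k
  | index, r => .op .or r 0 0
  | input e, r => .seq (e.code r) (.load r 0 r)
  | bin o e f, r => .seq (.seq (e.code r) (f.code (r + 1))) (.op o r r (r + 1))
  | ite c e f, r => .seq (c.code r) (.branch r (e.code r) (f.code r))

theorem width_pos (e : Expr) : 0 < e.width := by
  induction e <;> simp [width, *]

end Expr

/-- Started in the state `s`, the program halts within `T` steps with the value `v` in register `r`;
it changes no array and no register outside the range from `r` to `r + k - 1`. -/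
def Computes (w : ℕ) (p : Prog) (r k T : ℕ) (s : State) (v : ℕ) : Prop :=
  ∃ t s', Run w p s t s' ∧ t ≤ T ∧ s'.reg r = v ∧ s'.mem = s.mem ∧
    ∀ q, q < r ∨ r + k ≤ q → s'.reg q = s.reg q

theorem State.setReg_reg_self (s : State) (r v : ℕ) : (s.setReg r v).reg r = v := by
  simp only [State.setReg, Function.update_self]

theorem State.setReg_reg_of_ne (s : State) {q r : ℕ} (h : q ≠ r) (v : ℕ) :
    (s.setReg r v).reg q = s.reg q := by
  simp only [State.setReg, Function.update_of_ne h]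

namespace Computes

variable {w r k k' l T T' u v : ℕ} {p p' : Prog} {s : State}

theorem of_run_setReg (h : Run w p s 1 (s.setReg r v)) : Computes w p r 1 1 s v :=
  ⟨1, _, h, le_rfl, s.setReg_reg_self r v, rfl, fun _ hq => s.setReg_reg_of_ne (by omega) v⟩

theorem load (hk : 0 < k) (h : Computes w p r k T s v) (m : ℕ) :
    Computes w (.seq p (.load r m r)) r k (T + 1) s (s.mem m v) := by
  obtain ⟨t, s', hrun, ht, hv, hmem, hreg⟩ := h
  refine ⟨_, _, .seq hrun (.load r m r s'), by omega, ?_, hmem, fun q hq => ?_⟩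
  · rw [s'.setReg_reg_self, hv, hmem]
  · rw [s'.setReg_reg_of_ne (by omega), hreg q hq]

theorem op (h : Computes w p r k T s u)
    (h' : ∀ s', s'.mem = s.mem → (∀ q < r, s'.reg q = s.reg q) →
      Computes w p' (r + 1) k' T' s' v) (o : BinOp) :
    Computes w (.seq (.seq p p') (.op o r r (r + 1))) r (max k (k' + 1)) (T + T' + 1) s
      (o.eval w u v) := by
  obtain ⟨t₁, s₁, hrun₁, ht₁, hv₁, hmem₁, hreg₁⟩ := h
  obtain ⟨t₂, s₂, hrun₂, ht₂, hv₂, hmem₂, hreg₂⟩ := h' s₁ hmem₁ fun q hq => hreg₁ q (.inl hq)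
  refine ⟨_, _, .seq (.seq hrun₁ hrun₂) (.op o r r (r + 1) s₂), by omega, ?_, hmem₂.trans hmem₁,
    fun q hq => ?_⟩
  · rw [s₂.setReg_reg_self, hv₂, hreg₂ r (.inl r.lt_succ_self), hv₁]
  · rw [s₂.setReg_reg_of_ne (by omega), hreg₂ q (by omega), hreg₁ q (by omega)]

theorem mono (h : Computes w p r k T s v) (hk : k ≤ k') (hT : T ≤ T') :
    Computes w p r k' T' s v := by
  obtain ⟨t, s', hrun, ht, hv, hmem, hreg⟩ := h
  exact ⟨t, s', hrun, ht.trans hT, hv, hmem, fun q hq => hreg q (by omega)⟩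

theorem seq {c : Prog} (h : Computes w c r k T s u)
    (h' : ∀ s', s'.reg r = u → s'.mem = s.mem → (∀ q < r, s'.reg q = s.reg q) →
      Computes w p r k' T' s' v) :
    Computes w (.seq c p) r (max k k') (T + T') s v := by
  obtain ⟨t₁, s₁, hrun₁, ht₁, hv₁, hmem₁, hreg₁⟩ := h
  obtain ⟨t₂, s₂, hrun₂, ht₂, hv₂, hmem₂, hreg₂⟩ :=
    h' s₁ hv₁ hmem₁ fun q hq => hreg₁ q (.inl hq)
  refine ⟨_, s₂, .seq hrun₁ hrun₂, by omega, hv₂, hmem₂.trans hmem₁, fun q hq => ?_⟩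
  rw [hreg₂ q (by omega), hreg₁ q (by omega)]

theorem branch (h : s.reg l ≠ 0 → Computes w p r k T s u)
    (h' : s.reg l = 0 → Computes w p' r k' T' s v) :
    Computes w (.branch l p p') r (max k k') (max T T' + 1) s (if s.reg l = 0 then v else u) := by
  split_ifs with hl
  · obtain ⟨t, s', hrun, ht, hs'⟩ := (h' hl).mono (le_max_right k k') (le_max_right T T')
    exact ⟨_, s', .branch_false hl hrun, Nat.succ_le_succ ht, hs'⟩
  · obtain ⟨t, s', hrun, ht, hs'⟩ := (h hl).mono (le_max_left k k') (le_max_left T T')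
    exact ⟨_, s', .branch_true hl hrun, Nat.succ_le_succ ht, hs'⟩

end Computes

theorem Expr.computes_code (w : ℕ) (e : Expr) {r : ℕ} (hr : 0 < r) (s : State) :
    Computes w (e.code r) r e.width e.cost s (e.val w (s.mem 0) (s.reg 0)) := by
  induction e generalizing r s with
  | lit k => exact .of_run_setReg (.const r k s)
  | index =>
    have hrun : Run w (.op .or r 0 0) s 1 (s.setReg r (s.reg 0 ||| s.reg 0)) := .op .or r 0 0 s
    rw [Nat.or_self] at hrun
    exact .of_run_setReg hrun
  | input e he => exact (he hr s).load e.width_pos 0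
  | bin o e f he hf =>
    refine (he hr s).op (fun s' hmem hreg => ?_) o
    rw [← hmem, ← hreg 0 hr]
    exact hf r.succ_pos s'
  | ite c e f hc he hf =>
    refine (hc hr s).seq fun s' hs' hmem hreg => ?_
    rw [val, ← hs', ← hmem, ← hreg 0 hr]
    exact .branch (fun _ => he hr s') fun _ => hf hr s'

/-- Decrease the index in register `0`, then write the value of an expression to array `1`, at the
position given by the index. -/
def fillStep (e : Expr) : Prog :=
  .seq (.seq (.const 1 1) (.op .sub 0 0 1)) (.seq (e.code 1) (.store 1 0 1))

/-- Write the values of the expression `e` at all indices below the value of `l` to array `1`, the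
last one first. -/
def tabulate (l e : Expr) : Prog :=
  .seq (.seq (l.code 1) (.op .or 0 1 1)) (.loop 0 (fillStep e))

/-- The expressions `l` and `e` describe the list `y` in terms of the list `x`, on `w`-bit words. -/
structure Describes (w : ℕ) (l e : Expr) (x y : List ℕ) : Prop where
  length_lt : y.length < 2 ^ w
  val_length : l.val w (x.getD · 0) 0 = y.length
  val_entry : ∀ i < y.length, e.val w (x.getD · 0) i = y.getD i 0

/-- The state of `tabulate`, with input `x`, when the entries of the list `y` at positions at least
`i` have been written; the registers from `R` on are never used. -/
structure Filled (x y : List ℕ) (R i : ℕ) (s : State) : Prop where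
  index : s.reg 0 = i
  fresh : ∀ q, R ≤ q → s.reg q = 0
  input : s.mem 0 = (x.getD · 0)
  output : s.mem 1 = fun j => if i ≤ j then y.getD j 0 else 0
  empty : ∀ m, s.mem (m + 2) = fun _ => 0

/-- The state `σ` contains a copy of `s`, with registers renamed by `r ↦ r + R` and arrays by
`m ↦ m + 1`. -/
structure Embeds (R : ℕ) (s σ : State) : Prop where
  reg : ∀ r, σ.reg (r + R) = s.reg r
  mem : ∀ m, σ.mem (m + 1) = s.mem m

theorem BinOp.eval_sub {w a b : ℕ} (hb : b ≤ a) (ha : a < 2 ^ w) :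
    BinOp.sub.eval w a b = a - b := by
  rw [BinOp.eval, Nat.mod_eq_of_lt (hb.trans_lt ha),
    show a + (2 ^ w - b) = a - b + 2 ^ w by omega, Nat.add_mod_right, Nat.mod_eq_of_lt (by omega)]

section Tabulate

variable {w R i : ℕ} {x y : List ℕ} {l e : Expr} {s : State}

theorem Filled.exists_run_fillStep (h : Filled x y R (i + 1) s) (hi : i + 1 < 2 ^ w)
    (he : e.val w (x.getD · 0) i = y.getD i 0) (hR : e.width < R) :
    ∃ t s', Run w (fillStep e) s t s' ∧ t ≤ e.cost + 3 ∧ Filled x y R i s' := by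
  have hpos := e.width_pos
  set s₁ := s.setReg 1 1 with hs₁
  set s₂ := s₁.setReg 0 i with hs₂
  have hone : Run w (.const 1 1) s 1 s₁ := by
    have := Run.const (w := w) 1 1 s
    rwa [Nat.mod_eq_of_lt (by omega)] at this
  have hindex : Run w (.op .sub 0 0 1) s₁ 1 s₂ := by
    have := Run.op (w := w) .sub 0 0 1 s₁
    rwa [hs₁, s.setReg_reg_of_ne zero_ne_one, s.setReg_reg_self, h.index,
      BinOp.eval_sub (by omega) hi] at this
  obtain ⟨t, s₃, hrun, ht, hval, hmem, hreg⟩ := e.computes_code w one_pos s₂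
  have hreg_zero : s₃.reg 0 = i := (hreg 0 (.inl one_pos)).trans (s₁.setReg_reg_self 0 i)
  refine ⟨_, _, .seq (.seq hone hindex) (.seq hrun (.store 1 0 1 s₃)), by omega, hreg_zero,
    fun q hq => ?_, ?_, ?_, fun m => ?_⟩
  · change s₃.reg q = 0
    rw [hreg q (by omega), hs₂, s₁.setReg_reg_of_ne (by omega), hs₁, s.setReg_reg_of_ne (by omega),
      h.fresh q hq]
  · exact (congrFun hmem 0).trans h.input
  · have hval' : s₃.reg 1 = y.getD i 0 := by
      rw [hval, hs₂, s₁.setReg_reg_self, ← he, ← h.input]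
      rfl
    simp only [State.setMem, Function.update_self, hmem, hreg_zero, hval']
    funext j
    rcases eq_or_ne j i with rfl | hj
    · rw [Function.update_self, if_pos le_rfl]
    · rw [Function.update_of_ne hj, show s₂.mem 1 = s.mem 1 from rfl, h.output]
      exact if_congr (by omega) rfl rfl
  · exact (congrFun hmem (m + 2)).trans (h.empty m)

theorem Filled.exists_run_loop (h : Filled x y R i s) (hi : i < 2 ^ w)
    (he : ∀ j < i, e.val w (x.getD · 0) j = y.getD j 0) (hR : e.width < R) :
    ∃ t s', Run w (.loop 0 (fillStep e)) s t s' ∧ t ≤ i * (e.cost + 4) + 1 ∧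
      Filled x y R 0 s' := by
  induction i generalizing s with
  | zero => exact ⟨1, s, .loop_done h.index, by omega, h⟩
  | succ i ih =>
    obtain ⟨t₁, s₁, hrun₁, ht₁, h₁⟩ := h.exists_run_fillStep hi (he i i.lt_succ_self) hR
    obtain ⟨t₂, s₂, hrun₂, ht₂, h₂⟩ := ih h₁ (by omega) fun j hj => he j (by omega)
    have hne : s.reg 0 ≠ 0 := by simp [h.index]
    exact ⟨_, s₂, .loop_step hne hrun₁ hrun₂, by linarith, h₂⟩

theorem exists_filled_length (h : Describes w l e x y) (hR : l.width < R) :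
    ∃ t s, Run w (.seq (l.code 1) (.op .or 0 1 1)) (init x) t s ∧ t ≤ l.cost + 1 ∧
      Filled x y R y.length s := by
  obtain ⟨t, s, hrun, ht, hval, hmem, hreg⟩ := l.computes_code w one_pos (init x)
  refine ⟨_, _, .seq hrun (.op .or 0 1 1 s), by omega, ?_, fun q hq => ?_, ?_, ?_, fun m => ?_⟩
  · rw [s.setReg_reg_self, hval, ← h.val_length]
    exact Nat.or_self _
  · rw [s.setReg_reg_of_ne (by omega), hreg q (by omega)]
    rfl
  · exact congrFun hmem 0
  · refine (congrFun hmem 1).trans (funext fun j => ?_)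
    split_ifs with hj
    · exact (List.getD_eq_default y 0 hj).symm
    · rfl
  · exact congrFun hmem (m + 2)

theorem Filled.embeds (h : Filled x y R 0 s) : Embeds R (init y) s where
  reg r := h.fresh (r + R) (Nat.le_add_left R r)
  mem
    | 0 => h.output.trans (funext fun j => if_pos j.zero_le)
    | m + 1 => h.empty m

theorem exists_run_tabulate (h : Describes w l e x y) (hl : l.width < R) (he : e.width < R) :
    ∃ t s, Run w (tabulate l e) (init x) t s ∧
      t ≤ l.cost + 1 + (y.length * (e.cost + 4) + 1) ∧ Embeds R (init y) s := by
  obtain ⟨t₁, s₁, hrun₁, ht₁, h₁⟩ := exists_filled_length h hl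
  obtain ⟨t₂, s₂, hrun₂, ht₂, h₂⟩ := h₁.exists_run_loop h.length_lt h.val_entry he
  exact ⟨_, s₂, .seq hrun₁ hrun₂, add_le_add ht₁ ht₂, h₂.embeds⟩

end Tabulate

/-! ### Reductions on the word RAM -/

/-- The program with registers renamed by `r ↦ r + R` and arrays by `m ↦ m + 1`. -/
def Prog.shift (R : ℕ) : Prog → Prog
  | .const r k => .const (r + R) k
  | .op o r a b => .op o (r + R) (a + R) (b + R)
  | .load r m a => .load (r + R) (m + 1) (a + R)
  | .store m a b => .store (m + 1) (a + R) (b + R)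
  | .seq p q => .seq (p.shift R) (q.shift R)
  | .branch a p q => .branch (a + R) (p.shift R) (q.shift R)
  | .loop a p => .loop (a + R) (p.shift R)

section Shift

variable {R : ℕ} {s σ : State}

theorem Embeds.setReg (h : Embeds R s σ) (r v : ℕ) :
    Embeds R (s.setReg r v) (σ.setReg (r + R) v) where
  reg q := by
    rcases eq_or_ne q r with rfl | hq
    · rw [State.setReg_reg_self, State.setReg_reg_self]
    · rw [State.setReg_reg_of_ne _ hq, State.setReg_reg_of_ne _ (by omega), h.reg]
  mem := h.mem

theorem Embeds.setMem (h : Embeds R s σ) (m i v : ℕ) :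
    Embeds R (s.setMem m i v) (σ.setMem (m + 1) i v) where
  reg := h.reg
  mem q := by
    simp only [State.setMem, h.mem]
    rcases eq_or_ne q m with rfl | hq
    · rw [Function.update_self, Function.update_self]
    · rw [Function.update_of_ne hq, Function.update_of_ne (by omega), h.mem]

theorem Run.exists_shift {w t : ℕ} {p : Prog} {s' : State} (hrun : Run w p s t s')
    (h : Embeds R s σ) : ∃ σ', Run w (p.shift R) σ t σ' ∧ Embeds R s' σ' := by
  induction hrun generalizing σ with
  | const r k s => exact ⟨_, .const _ _ _, h.setReg _ _⟩
  | op o r a b s => exact ⟨_, .op _ _ _ _ _, by rw [h.reg, h.reg]; exact h.setReg _ _⟩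
  | load r m a s => exact ⟨_, .load _ _ _ _, by rw [h.reg, h.mem]; exact h.setReg _ _⟩
  | store m a b s => exact ⟨_, .store _ _ _ _, by rw [h.reg, h.reg]; exact h.setMem _ _ _⟩
  | seq _ _ ih₁ ih₂ =>
    obtain ⟨_, hrun₁, h₁⟩ := ih₁ h
    obtain ⟨_, hrun₂, h₂⟩ := ih₂ h₁
    exact ⟨_, .seq hrun₁ hrun₂, h₂⟩
  | branch_true ha _ ih =>
    obtain ⟨_, hrun₁, h₁⟩ := ih h
    exact ⟨_, .branch_true (by rwa [h.reg]) hrun₁, h₁⟩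
  | branch_false ha _ ih =>
    obtain ⟨_, hrun₁, h₁⟩ := ih h
    exact ⟨_, .branch_false (by rwa [h.reg]) hrun₁, h₁⟩
  | loop_done ha => exact ⟨_, .loop_done (by rwa [h.reg]), h⟩
  | loop_step ha _ _ ih₁ ih₂ =>
    obtain ⟨_, hrun₁, h₁⟩ := ih₁ h
    obtain ⟨_, hrun₂, h₂⟩ := ih₂ h₁
    exact ⟨_, .loop_step (by rwa [h.reg]) hrun₁ hrun₂, h₂⟩

end Shift

/-- A many-one reduction whose output is described entry by entry by fixed expressions, on words of
`k * log₂ (N + 2)` bits for inputs of length `N`. -/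
structure Reduction (A B : DecisionProblem) where
  map : A.Inst → B.Inst
  yes_map : ∀ I, B.Yes (map I) ↔ A.Yes I
  length : Expr
  entry : Expr
  k : ℕ
  length_words_map : ∀ I, (B.words (map I)).length + 2 ≤ ((A.words I).length + 2) ^ k
  describes : ∀ I w, ((A.words I).length + 2) ^ k ≤ 2 ^ w →
    Describes w length entry (A.words I) (B.words (map I))

namespace Reduction

variable {A B : DecisionProblem} (red : Reduction A B)

/-- The number of registers that the reduction uses. -/
def width : ℕ := max red.length.width red.entry.width + 1

/-- The time that the reduction takes per word of its output, up to the additive constant `1`. -/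
def cost : ℕ := red.length.cost + red.entry.cost + 6

/-- Run the reduction, then `p` in a fresh part of the memory, and copy its answer. -/
def prog (p : Prog) : Prog :=
  .seq (tabulate red.length red.entry) (.seq (p.shift red.width) (.op .or 0 red.width red.width))

variable {red}

theorem exists_run_prog {p : Prog} {w t : ℕ} {s : State} {I : A.Inst}
    (hw : ((A.words I).length + 2) ^ red.k ≤ 2 ^ w)
    (hrun : Run w p (init (B.words (red.map I))) t s) :
    ∃ t' s', Run w (red.prog p) (init (A.words I)) t' s' ∧
      t' ≤ red.cost * ((B.words (red.map I)).length + 1) + t ∧ s'.reg 0 = s.reg 0 := by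
  obtain ⟨t₁, s₁, hrun₁, ht₁, h₁⟩ := exists_run_tabulate (R := red.width) (red.describes I w hw)
    (Nat.lt_succ_of_le (le_max_left _ _)) (Nat.lt_succ_of_le (le_max_right _ _))
  obtain ⟨s₂, hrun₂, h₂⟩ := hrun.exists_shift h₁
  refine ⟨_, _, .seq hrun₁ (.seq hrun₂ (.op .or 0 red.width red.width s₂)), ?_, ?_⟩
  · unfold cost
    nlinarith [Nat.zero_le (red.length.cost * (B.words (red.map I)).length)]
  · rw [State.setReg_reg_self, ← h₂.reg 0, zero_add]
    exact Nat.or_self _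

end Reduction

end WordRAM

open WordRAM in
theorem DecisionProblem.SolvableInTime.of_reduction {A B : DecisionProblem} {f g : ℕ → ℝ} {K : ℝ}
    (red : Reduction A B) (h : B.SolvableInTime g)
    (hlength : ∀ I, ((B.words (red.map I)).length + 1 : ℝ) ≤ K * f (A.size I))
    (htime : ∀ I, |g (B.size (red.map I))| ≤ K * f (A.size I)) : A.SolvableInTime f := by
  obtain ⟨p, c, C, hp⟩ := h
  refine ⟨red.prog p, red.k * (c + 1), (red.cost + |C|) * K, fun I w hw => ?_⟩
  have hN : 0 < (A.words I).length + 2 := Nat.succ_pos _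
  have hwA : ((A.words I).length + 2) ^ red.k ≤ 2 ^ w :=
    (Nat.pow_le_pow_right hN (Nat.le_mul_of_pos_right _ c.succ_pos)).trans hw
  have hwB : ((B.words (red.map I)).length + 2) ^ c ≤ 2 ^ w := calc
    _ ≤ (((A.words I).length + 2) ^ red.k) ^ c := Nat.pow_le_pow_left (red.length_words_map I) c
    _ = ((A.words I).length + 2) ^ (red.k * c) := (pow_mul _ _ _).symm
    _ ≤ ((A.words I).length + 2) ^ (red.k * (c + 1)) :=
      Nat.pow_le_pow_right hN (Nat.mul_le_mul_left _ c.le_succ)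
    _ ≤ 2 ^ w := hw
  obtain ⟨t, s, hrun, ht, hs⟩ := hp (red.map I) w hwB
  obtain ⟨t', s', hrun', ht', hs'⟩ := Reduction.exists_run_prog hwA hrun
  refine ⟨t', s', hrun', ?_, by rw [hs', hs, red.yes_map]⟩
  have hC : C * g (B.size (red.map I)) ≤ |C| * (K * f (A.size I)) := calc
    _ ≤ |C * g (B.size (red.map I))| := le_abs_self _
    _ = |C| * |g (B.size (red.map I))| := abs_mul _ _
    _ ≤ |C| * (K * f (A.size I)) := by gcongr; exact htime I
  calc (t' : ℝ) ≤ red.cost * ((B.words (red.map I)).length + 1) + t := by exact_mod_cast ht'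
    _ ≤ red.cost * (K * f (A.size I)) + |C| * (K * f (A.size I)) := by
      gcongr
      · exact hlength I
      · exact ht.trans hC
    _ = (red.cost + |C|) * K * f (A.size I) := by ring

namespace WordRAM.Expr

instance : Add Expr := ⟨bin .add⟩
instance : Sub Expr := ⟨bin .sub⟩
instance : Mul Expr := ⟨bin .mul⟩
instance : Div Expr := ⟨bin .div⟩
instance : Mod Expr := ⟨bin .mod⟩
instance (k : ℕ) : OfNat Expr k := ⟨lit k⟩

/-- The value of `u` if that of `e` is at most that of `f`, else the value of `v`. -/
def ifLe (e f u v : Expr) : Expr := ite (bin .lt f e) v u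

/-- The value of `u` if that of `e` is less than that of `f`, else the value of `v`. -/
def ifLt (e f u v : Expr) : Expr := ite (bin .lt e f) u v

/-- The value of `u` if those of `e` and `f` are equal, else the value of `v`. -/
def ifEq (e f u v : Expr) : Expr := ite (bin .eq e f) u v

section Val

variable {w i a b p q : ℕ} {x : ℕ → ℕ} {e f u v : Expr}

theorem val_lit (h : a < 2 ^ w) : (lit a).val w x i = a := Nat.mod_eq_of_lt h

theorem val_ofNat {k : ℕ} (h : OfNat.ofNat k < 2 ^ w) :
    (OfNat.ofNat k : Expr).val w x i = OfNat.ofNat k :=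
  Nat.mod_eq_of_lt h

theorem val_input (he : e.val w x i = a) : (input e).val w x i = x a := congrArg x he

theorem val_add (he : e.val w x i = a) (hf : f.val w x i = b) (h : a + b < 2 ^ w) :
    (e + f).val w x i = a + b := by
  change BinOp.add.eval w _ _ = _
  rw [he, hf, BinOp.eval, Nat.mod_eq_of_lt h]

theorem val_sub (he : e.val w x i = a) (hf : f.val w x i = b) (hb : b ≤ a) (ha : a < 2 ^ w) :
    (e - f).val w x i = a - b := by
  change BinOp.sub.eval w _ _ = _
  rw [he, hf, BinOp.eval_sub hb ha]

theorem val_mul (he : e.val w x i = a) (hf : f.val w x i = b) (h : a * b < 2 ^ w) :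
    (e * f).val w x i = a * b := by
  change BinOp.mul.eval w _ _ = _
  rw [he, hf, BinOp.eval, Nat.mod_eq_of_lt h]

theorem val_div (he : e.val w x i = a) (hf : f.val w x i = b) : (e / f).val w x i = a / b :=
  congrArg₂ (· / ·) he hf

theorem val_mod (he : e.val w x i = a) (hf : f.val w x i = b) : (e % f).val w x i = a % b :=
  congrArg₂ (· % ·) he hf

theorem val_eq (he : e.val w x i = a) (hf : f.val w x i = b) :
    (bin .eq e f).val w x i = (decide (a = b)).toNat := by
  rw [val, he, hf, BinOp.eval]
  split_ifs with h <;> simp [h]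

theorem val_lt (he : e.val w x i = a) (hf : f.val w x i = b) :
    (bin .lt e f).val w x i = (decide (a < b)).toNat := by
  rw [val, he, hf, BinOp.eval]
  split_ifs with h <;> simp [h]

theorem val_ite {c : Prop} [Decidable c] (he : e.val w x i = (decide c).toNat)
    (hu : c → u.val w x i = p) (hv : ¬c → v.val w x i = q) :
    (ite e u v).val w x i = if c then p else q := by
  rw [val, he]
  by_cases hc : c
  · simp [hc, hu hc]
  · simp [hc, hv hc]

theorem val_ifLe (he : e.val w x i = a) (hf : f.val w x i = b) (hu : a ≤ b → u.val w x i = p)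
    (hv : b < a → v.val w x i = q) : (ifLe e f u v).val w x i = if a ≤ b then p else q := by
  rw [ifLe, val_ite (val_lt hf he) hv fun h => hu (not_lt.1 h)]
  split_ifs <;> first | rfl | omega

theorem val_ifLt (he : e.val w x i = a) (hf : f.val w x i = b) (hu : a < b → u.val w x i = p)
    (hv : b ≤ a → v.val w x i = q) : (ifLt e f u v).val w x i = if a < b then p else q :=
  val_ite (val_lt he hf) hu fun h => hv (not_lt.1 h)

theorem val_ifEq (he : e.val w x i = a) (hf : f.val w x i = b) (hu : a = b → u.val w x i = p)
    (hv : a ≠ b → v.val w x i = q) : (ifEq e f u v).val w x i = if a = b then p else q :=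
  val_ite (val_eq he hf) hu hv

theorem val_not {c : Bool} (h : 0 < 2 ^ w) (he : e.val w x i = c.toNat) :
    (bin .eq e 0).val w x i = (!c).toNat := by
  rw [val_eq he (val_ofNat h)]
  cases c <;> rfl

end Val

end WordRAM.Expr

/-! ### The entries of the constructed instance -/

namespace BarkingReduction

open WordRAM Expr

/-- The 0-1 vectors of length `d` stored in `x` one after the other, from position `p` on. -/
def rowBits (x : ℕ → ℕ) (d p i c : ℕ) : Bool := x (p + (i * d + c)) = 1

/-- The number `n` of vectors of an input. -/
def countExpr : Expr := input 0

/-- The dimension `d` of an input. -/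
def dimExpr : Expr := input 1

/-- The expression for `rowBits`. -/
def bitExpr (p j c : Expr) : Expr := bin .eq (input (p + (j * dimExpr + c))) 1

/-- The expression for `wave`. -/
def waveExpr (row : Expr → Expr) (o : Expr) : Expr := ifEq (o % 4) 2 (2 * row (o / 4)) (o % 2)

/-- The expression for `dogBlock`. -/
def dogBlockExpr (row : Expr → Expr) (o : Expr) : Expr :=
  ifLe o 1 o <|
  ifLe o (4 * dimExpr + 2) (2 + waveExpr row (o - 2)) <|
  ifLe o (4 * dimExpr + 7) (o - (4 * dimExpr + 2)) <|
  ifLe o (4 * dimExpr + 10) (4 * dimExpr + 12 - o) <|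
  ifLe o (4 * dimExpr + 18) (2 + o % 2) (4 * dimExpr + 20 - o)

/-- The expression for `dogLevel`, for the second family of vectors of the input. -/
def dogLevelExpr (m : Expr) : Expr :=
  dogBlockExpr (bitExpr (2 + countExpr * dimExpr) (m / (4 * dimExpr + 20)))
    (m % (4 * dimExpr + 20))

/-- The expression for `hikerGadget`. -/
def hikerGadgetExpr (row : Expr → Expr) (o : Expr) : Expr :=
  ifEq o 0 1 <|
  ifLe o (4 * dimExpr + 1) (2 + waveExpr (fun c => bin .eq (row c) 0) (o - 1)) 1

/-- The expression for `blockStart d n`. -/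
def blockStartExpr : Expr := countExpr * (4 * dimExpr + 20)

/-- The expression for `slot n d`. -/
def slotExpr (i : Expr) : Expr := blockStartExpr + 6 + i * (4 * dimExpr + 2)

/-- The expression for `hikerLevel`, for the first family of vectors of the input. -/
def hikerLevelExpr (k : Expr) : Expr :=
  ifLe k blockStartExpr (5 + k % 2) <|
  ifLe k (blockStartExpr + 5) (blockStartExpr + 5 - k) <|
  ifLt k (slotExpr countExpr)
    (hikerGadgetExpr (bitExpr 2 ((k - slotExpr 0) / (4 * dimExpr + 2)))
      ((k - slotExpr 0) % (4 * dimExpr + 2))) <|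
  ifLe k (slotExpr countExpr + 10) (1 + (k - slotExpr countExpr)) <|
  ifLe k (slotExpr countExpr + 16) (slotExpr countExpr + 21 - k) (5 + k % 2)

section Levels

variable {w i n d : ℕ} {x : ℕ → ℕ}

theorem val_countExpr (hn : x 0 = n) : countExpr.val w x i = n :=
  (val_input (val_ofNat (Nat.two_pow_pos w))).trans hn

theorem val_dimExpr (hw : 1 < 2 ^ w) (hd : x 1 = d) : dimExpr.val w x i = d :=
  (val_input (val_ofNat hw)).trans hd

theorem val_four_mul_dimExpr_add (hd : x 1 = d) {c : ℕ} (hc : 0 < OfNat.ofNat c)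
    (h : 4 * d + OfNat.ofNat c < 2 ^ w) (hw : 4 < 2 ^ w) :
    (4 * dimExpr + OfNat.ofNat c).val w x i = 4 * d + OfNat.ofNat c :=
  val_add (val_mul (val_ofNat hw) (val_dimExpr (by omega) hd) (by omega)) (val_ofNat (by omega)) h

theorem val_bitExpr (hw : 1 < 2 ^ w) (hd : x 1 = d) {p j c : Expr} {π γ η : ℕ}
    (hp : p.val w x i = π) (hj : j.val w x i = γ) (hc : c.val w x i = η)
    (h : π + (γ * d + η) < 2 ^ w) : (bitExpr p j c).val w x i = (rowBits x d π γ η).toNat :=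
  val_eq (val_input (val_add hp (val_add (val_mul hj (val_dimExpr hw hd) (by omega)) hc (by omega))
    h)) (val_ofNat hw)

theorem val_waveExpr (hw : 4 < 2 ^ w) {row : Expr → Expr} {r : ℕ → Bool} {o : Expr} {ω : ℕ}
    (ho : o.val w x i = ω)
    (hrow : ∀ c γ, c.val w x i = γ → γ ≤ ω → (row c).val w x i = (r γ).toNat) :
    (waveExpr row o).val w x i = wave r ω := by
  have hbit := hrow _ _ (val_div ho (val_ofNat hw)) (Nat.div_le_self ω 4)
  have := Bool.toNat_le (r (ω / 4))
  exact val_ifEq (val_mod ho (val_ofNat hw)) (val_ofNat (by omega))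
    (fun _ => val_mul (val_ofNat (by omega)) hbit (by omega))
    fun _ => val_mod ho (val_ofNat (by omega))

theorem val_dogBlockExpr (hd : x 1 = d) {row : Expr → Expr} {r : ℕ → Bool} {o : Expr} {ω : ℕ}
    (ho : o.val w x i = ω) (hω : ω ≤ 4 * d + 20) (hw : 4 * d + 20 < 2 ^ w)
    (hrow : ∀ c γ, c.val w x i = γ → γ ≤ ω → (row c).val w x i = (r γ).toNat) :
    (dogBlockExpr row o).val w x i = dogBlock d r ω := by
  have hadd {c : ℕ} (hc : 0 < OfNat.ofNat c) (hc' : OfNat.ofNat c ≤ 20) :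
      (4 * dimExpr + OfNat.ofNat c).val w x i = 4 * d + OfNat.ofNat c :=
    val_four_mul_dimExpr_add hd hc (by omega) (by omega)
  have hlit {c : ℕ} (hc : OfNat.ofNat c ≤ 20) : (OfNat.ofNat c : Expr).val w x i = OfNat.ofNat c :=
    val_ofNat (by omega)
  have hwave := wave_le_two r (ω - 2)
  refine val_ifLe ho (hlit (by norm_num)) (fun _ => ho) fun h₁ =>
    val_ifLe ho (hadd two_pos (by norm_num)) (fun _ => ?_) fun h₂ =>
    val_ifLe ho (hadd (by norm_num) (by norm_num)) (fun _ => ?_) fun h₃ =>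
    val_ifLe ho (hadd (by norm_num) (by norm_num)) (fun h => ?_) fun h₄ =>
    val_ifLe ho (hadd (by norm_num) (by norm_num)) (fun _ => ?_) fun _ => ?_
  · refine val_add (hlit (by norm_num)) (val_waveExpr (by omega)
      (val_sub ho (hlit (by norm_num)) (by omega) (by omega)) fun c γ hc hγ => ?_) (by omega)
    exact hrow c γ hc (by omega)
  · exact val_sub ho (hadd two_pos (by norm_num)) (by omega) (by omega)
  · exact val_sub (hadd (by norm_num) (by norm_num)) ho (by omega) (by omega)
  · exact val_add (hlit (by norm_num)) (val_mod ho (hlit (by norm_num))) (by omega)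
  · exact val_sub (hadd (by norm_num) (by norm_num)) ho (by omega) (by omega)

theorem div_mul_add_le {m k γ : ℕ} (h : γ ≤ m % k) (hd : d ≤ k) : m / k * d + γ ≤ m := by
  have := Nat.div_add_mod' m k
  have := Nat.mul_le_mul_left (m / k) hd
  omega

theorem val_dogLevelExpr (hn : x 0 = n) (hd : x 1 = d) {m : Expr} {μ : ℕ}
    (hm : m.val w x i = μ) (hw : n * d + 4 * d + 22 + μ < 2 ^ w) :
    (dogLevelExpr m).val w x i = dogLevel d (rowBits x d (2 + n * d)) μ := by
  have hblock : (4 * dimExpr + 20).val w x i = 4 * d + 20 :=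
    val_four_mul_dimExpr_add hd (by norm_num) (by omega) (by omega)
  refine val_dogBlockExpr hd (val_mod hm hblock) (Nat.mod_lt _ (by omega)).le (by omega)
    fun c γ hc hγ => val_bitExpr (by omega) hd (val_add (val_ofNat (by omega)) (val_mul
      (val_countExpr hn) (val_dimExpr (by omega) hd) (by omega)) (by omega))
      (val_div hm hblock) hc ?_
  have := div_mul_add_le hγ (show d ≤ 4 * d + 20 by omega)
  omega

theorem val_hikerGadgetExpr (hd : x 1 = d) {row : Expr → Expr} {r : ℕ → Bool} {o : Expr} {ω : ℕ}
    (ho : o.val w x i = ω) (hω : ω ≤ 4 * d + 2) (hw : 4 * d + 4 < 2 ^ w)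
    (hrow : ∀ c γ, c.val w x i = γ → γ ≤ ω → (row c).val w x i = (r γ).toNat) :
    (hikerGadgetExpr row o).val w x i = hikerGadget d r ω := by
  have hlit {c : ℕ} (hc : OfNat.ofNat c ≤ 2) : (OfNat.ofNat c : Expr).val w x i = OfNat.ofNat c :=
    val_ofNat (by omega)
  have hwave := wave_le_two (fun c => !r c) (ω - 1)
  refine val_ifEq ho (hlit (by norm_num)) (fun _ => hlit (by norm_num)) fun h =>
    val_ifLe ho (val_four_mul_dimExpr_add hd one_pos (by omega) (by omega)) (fun _ => ?_)
      fun _ => hlit (by norm_num)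
  refine val_add (hlit le_rfl) (val_waveExpr (by omega)
    (val_sub ho (hlit (by norm_num)) (by omega) (by omega)) fun c γ hc hγ => ?_) (by omega)
  exact val_not (by omega) (hrow c γ hc (by omega))

theorem val_blockStartExpr (hn : x 0 = n) (hd : x 1 = d) (hw : 4 * d + 20 < 2 ^ w)
    (h : blockStart d n < 2 ^ w) : blockStartExpr.val w x i = blockStart d n :=
  val_mul (val_countExpr hn) (val_four_mul_dimExpr_add hd (by norm_num) hw (by omega)) h

theorem val_slotExpr (hn : x 0 = n) (hd : x 1 = d) (hw : 4 * d + 20 < 2 ^ w) {e : Expr} {j : ℕ}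
    (he : e.val w x i = j) (h : slot n d j < 2 ^ w) : (slotExpr e).val w x i = slot n d j := by
  have := blockStart_add_six_le_slot (n := n) (d := d) j
  refine val_add (val_add (val_blockStartExpr hn hd hw (by omega)) (val_ofNat (by omega))
    (by omega)) (val_mul he (val_four_mul_dimExpr_add hd two_pos (by omega) (by omega)) ?_) h
  unfold slot at h
  omega

theorem val_hikerLevelExpr (hn : x 0 = n) (hd : x 1 = d) {k : Expr} {μ : ℕ}
    (hk : k.val w x i = μ) (hw : slot n d n + 4 * d + 22 + μ < 2 ^ w) :
    (hikerLevelExpr k).val w x i = hikerLevel n d (rowBits x d 2) μ := by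
  have hblock := blockStart_add_six_le_slot (d := d) (n := n) n
  have hslot := slot_mono (d := d) (n := n) n.zero_le
  have hlit {c : ℕ} (hc : OfNat.ofNat c ≤ 21) : (OfNat.ofNat c : Expr).val w x i = OfNat.ofNat c :=
    val_ofNat (by omega)
  have hstart : blockStartExpr.val w x i = blockStart d n :=
    val_blockStartExpr hn hd (by omega) (by omega)
  have hfirst : (slotExpr 0).val w x i = slot n d 0 :=
    val_slotExpr hn hd (by omega) (hlit (by norm_num)) (by omega)
  have hlast : (slotExpr countExpr).val w x i = slot n d n :=
    val_slotExpr hn hd (by omega) (val_countExpr hn) (by omega)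
  have hperiod : (4 * dimExpr + 2).val w x i = 4 * d + 2 :=
    val_four_mul_dimExpr_add hd two_pos (by omega) (by omega)
  have hidle : (5 + k % 2).val w x i = 5 + μ % 2 :=
    val_add (hlit (by norm_num)) (val_mod hk (hlit (by norm_num))) (by omega)
  have hbottom : (blockStartExpr + 5).val w x i = blockStart d n + 5 :=
    val_add hstart (hlit (by norm_num)) (by omega)
  have hlast_add {c : ℕ} (hc : OfNat.ofNat c ≤ 21) :
      (slotExpr countExpr + OfNat.ofNat c).val w x i = slot n d n + OfNat.ofNat c :=
    val_add hlast (hlit hc) (by omega)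
  refine val_ifLe hk hstart (fun _ => hidle) fun _ =>
    val_ifLe hk hbottom (fun _ => val_sub hbottom hk (by omega) (by omega)) fun _ =>
    val_ifLt hk hlast (fun _ => ?_) fun _ =>
    val_ifLe hk (hlast_add (by norm_num)) (fun _ => val_add (hlit (by norm_num))
      (val_sub hk hlast (by omega) (by omega)) (by omega)) fun _ =>
    val_ifLe hk (hlast_add (by norm_num))
      (fun _ => val_sub (hlast_add (by norm_num)) hk (by omega) (by omega)) fun _ => hidle
  have hsub := val_sub hk hfirst (by rw [slot_zero]; omega) (by omega)
  refine val_hikerGadgetExpr hd (val_mod hsub hperiod) (Nat.mod_lt _ (by omega)).le (by omega)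
    fun c γ hc hγ => val_bitExpr (by omega) hd (hlit (by norm_num)) (val_div hsub hperiod) hc ?_
  have := div_mul_add_le hγ (show d ≤ 4 * d + 2 by omega)
  omega

end Levels

/-- The expression for the number `edges n d + 1` of vertices of each of the two polylines. -/
def sizeExpr : Expr := 4 * blockStartExpr + 1

/-- The expression for `dogQuarter`, for the second family of vectors of the input. -/
def dogQuarterExpr (i : Expr) : Expr :=
  (4 - i % 4) * dogLevelExpr (i / 4) + i % 4 * dogLevelExpr (i / 4 + 1)

/-- Word `e` of a point, given the expressions for its five words. -/
def pointExpr (signX absX signY absY den e : Expr) : Expr :=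
  ifEq e 0 signX <| ifEq e 1 absX <| ifEq e 2 signY <| ifEq e 3 absY den

/-- The expression for word `e` of the vertex `k` of the hiker's polyline. -/
def hikerPointExpr (a b : ℕ) (k e : Expr) : Expr :=
  pointExpr 0 (lit a * 8 * sizeExpr * hikerLevelExpr k) 0 (lit a * 4 * (k + 1))
    (lit b * 8 * sizeExpr) e

/-- The expression for word `e` of the vertex `i` of the dog's polyline. -/
def dogPointExpr (a b : ℕ) (i e : Expr) : Expr :=
  pointExpr 0 (lit a * 2 * sizeExpr * (dogQuarterExpr i + 12)) 1 (lit a * (i + 1))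
    (lit b * 8 * sizeExpr) e

section Sizes

variable {a b n d : ℕ} {α β : ℕ → ℕ → Bool}

theorem four_mul_add_twenty_le_blockStart (hn : 1 ≤ n) : 4 * d + 20 ≤ blockStart d n :=
  Nat.le_mul_of_pos_left _ hn

theorem mul_le_blockStart (n d : ℕ) : n * d ≤ blockStart d n :=
  Nat.mul_le_mul_left n (by omega)

theorem dogQuarter_le_twenty (i : ℕ) : dogQuarter d β i ≤ 20 := by
  have := Nat.mod_lt i four_pos
  calc dogQuarter d β i ≤ (4 - i % 4) * 5 + i % 4 * 5 :=
        Nat.add_le_add (Nat.mul_le_mul_left _ (dogLevel_le_five _))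
          (Nat.mul_le_mul_left _ (dogLevel_le_five _))
    _ = 20 := by omega

theorem boundedBy_hikerPoint (hb : 0 < b) {k : ℕ} (hk : k ≤ edges n d) :
    (hikerPoint a b hb n d α k).BoundedBy (100 * ((a + b) * (edges n d + 1))) := by
  have hx : a * 8 * (edges n d + 1) * hikerLevel n d α k ≤ a * 8 * (edges n d + 1) * 11 :=
    Nat.mul_le_mul_left _ (hikerLevel_le_eleven k)
  have hy : a * 4 * (k + 1) ≤ a * 4 * (edges n d + 1) := Nat.mul_le_mul_left _ (by omega)
  refine ⟨hx.trans ?_, (Int.natAbs_natCast _).trans_le (hy.trans ?_), ?_⟩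
  · nlinarith
  · nlinarith
  · change b * 8 * (edges n d + 1) ≤ _
    nlinarith

theorem boundedBy_dogPoint (hb : 0 < b) {i : ℕ} (hi : i ≤ edges n d) :
    (dogPoint a b hb n d β i).BoundedBy (100 * ((a + b) * (edges n d + 1))) := by
  have hx : a * 2 * (edges n d + 1) * (dogQuarter d β i + 12) ≤ a * 2 * (edges n d + 1) * 32 :=
    Nat.mul_le_mul_left _ (Nat.add_le_add_right (dogQuarter_le_twenty i) 12)
  have hy : a * (i + 1) ≤ a * (edges n d + 1) := Nat.mul_le_mul_left _ (by omega)
  refine ⟨hx.trans ?_, ((Int.natAbs_neg _).trans (Int.natAbs_natCast _)).trans_le (hy.trans ?_), ?_⟩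
  · nlinarith
  · nlinarith
  · change b * 8 * (edges n d + 1) ≤ _
    nlinarith

end Sizes

section Points

variable {w i n d a b : ℕ} {x : ℕ → ℕ} {e k : Expr} {η μ : ℕ}

theorem val_pointExpr {P : RatPoint} {signX absX signY absY den : Expr} (hw : 3 < 2 ^ w)
    (he : e.val w x i = η) (hη : η < 5) (hsignX : signX.val w x i = if P.x < 0 then 1 else 0)
    (habsX : absX.val w x i = P.x.natAbs) (hsignY : signY.val w x i = if P.y < 0 then 1 else 0)
    (habsY : absY.val w x i = P.y.natAbs) (hden : den.val w x i = P.den) :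
    (pointExpr signX absX signY absY den e).val w x i = P.words.getD η 0 := by
  rw [pointExpr, val_ifEq he (val_ofNat (by omega)) (fun _ => hsignX) fun _ =>
    val_ifEq he (val_ofNat (by omega)) (fun _ => habsX) fun _ =>
    val_ifEq he (val_ofNat (by omega)) (fun _ => hsignY) fun _ =>
    val_ifEq he (val_ofNat hw) (fun _ => habsY) fun _ => hden]
  interval_cases η <;> rfl

theorem val_sizeExpr (hn : x 0 = n) (hd : x 1 = d) (hpos : 1 ≤ n)
    (hw : edges n d + 1 < 2 ^ w) : sizeExpr.val w x i = edges n d + 1 := by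
  have hblock := four_mul_add_twenty_le_blockStart (d := d) hpos
  unfold edges at hw
  exact val_add (val_mul (val_ofNat (by omega)) (val_blockStartExpr hn hd (by omega) (by omega))
    (by omega)) (val_ofNat (by omega)) hw

theorem val_dogQuarterExpr (hn : x 0 = n) (hd : x 1 = d) (hk : k.val w x i = μ)
    (hw : n * d + 4 * d + 50 + μ < 2 ^ w) :
    (dogQuarterExpr k).val w x i = dogQuarter d (rowBits x d (2 + n * d)) μ := by
  have hlit {c : ℕ} (hc : OfNat.ofNat c ≤ 4) : (OfNat.ofNat c : Expr).val w x i = OfNat.ofNat c :=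
    val_ofNat (by omega)
  have hmod := val_mod hk (hlit le_rfl)
  have hdiv := val_div hk (hlit le_rfl)
  have hbound : dogQuarter d (rowBits x d (2 + n * d)) μ < 2 ^ w :=
    (dogQuarter_le_twenty μ).trans_lt (by omega)
  refine val_add
    (val_mul (val_sub (hlit le_rfl) hmod (Nat.mod_lt _ four_pos).le (by omega))
      (val_dogLevelExpr hn hd hdiv (by omega)) ?_)
    (val_mul hmod (val_dogLevelExpr hn hd (val_add hdiv (hlit (by norm_num)) (by omega))
      (by omega)) ?_) hbound
  · exact (Nat.le_add_right _ _).trans_lt hbound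
  · exact (Nat.le_add_left _ _).trans_lt hbound

theorem val_hikerPointExpr (hn : x 0 = n) (hd : x 1 = d) (hpos : 1 ≤ n) (hb : 0 < b)
    (hk : k.val w x i = μ) (hμ : μ ≤ edges n d) (he : e.val w x i = η) (hη : η < 5)
    (hw : 100 * ((a + b + 1) * (edges n d + 1)) < 2 ^ w) :
    (hikerPointExpr a b k e).val w x i =
      (hikerPoint a b hb n d (rowBits x d 2) μ).words.getD η 0 := by
  have hN : 100 * ((a + b) * (edges n d + 1)) + 100 * (edges n d + 1) < 2 ^ w := by linarith
  have ha : a + b ≤ (a + b) * (edges n d + 1) := Nat.le_mul_of_pos_right _ (Nat.succ_pos _)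
  have haN : (a + b) * (edges n d + 1) = a * (edges n d + 1) + b * (edges n d + 1) := add_mul _ _ _
  obtain ⟨hX, hY, hden⟩ := boundedBy_hikerPoint (a := a) (α := rowBits x d 2) hb hμ
  have hslot := slot_add_blockStart_le (d := d) hpos
  have hblock := four_mul_add_twenty_le_blockStart (d := d) hpos
  have hedges : edges n d = 4 * blockStart d n := rfl
  have hsize := val_sizeExpr (w := w) (i := i) hn hd hpos (by omega)
  have hlit {c : ℕ} (hc : OfNat.ofNat c ≤ 8) : (OfNat.ofNat c : Expr).val w x i = OfNat.ofNat c :=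
    val_ofNat (by omega)
  have hlevel := val_hikerLevelExpr hn hd hk (by omega)
  refine val_pointExpr (by omega) he hη (hlit (by norm_num)) ?_ (hlit (by norm_num)) ?_ ?_
  · exact val_mul (val_mul (val_mul (val_lit (by omega)) (hlit le_rfl) (by omega)) hsize
      (by rw [mul_right_comm]; omega)) hlevel (hX.trans_lt (by omega))
  · exact val_mul (val_mul (val_lit (by omega)) (hlit (by norm_num)) (by omega))
      (val_add hk (hlit (by norm_num)) (by omega)) (hY.trans_lt (by omega))
  · exact val_mul (val_mul (val_lit (by omega)) (hlit le_rfl) (by omega)) hsize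
      (hden.trans_lt (by omega))

theorem val_dogPointExpr (hn : x 0 = n) (hd : x 1 = d) (hpos : 1 ≤ n) (ha : 0 < a) (hb : 0 < b)
    (hk : k.val w x i = μ) (hμ : μ ≤ edges n d) (he : e.val w x i = η) (hη : η < 5)
    (hw : 100 * ((a + b + 1) * (edges n d + 1)) < 2 ^ w) :
    (dogPointExpr a b k e).val w x i =
      (dogPoint a b hb n d (rowBits x d (2 + n * d)) μ).words.getD η 0 := by
  have hN : 100 * ((a + b) * (edges n d + 1)) + 100 * (edges n d + 1) < 2 ^ w := by linarith
  have hab : a + b ≤ (a + b) * (edges n d + 1) := Nat.le_mul_of_pos_right _ (Nat.succ_pos _)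
  have habN : (a + b) * (edges n d + 1) = a * (edges n d + 1) + b * (edges n d + 1) :=
    add_mul _ _ _
  obtain ⟨hX, hY, hden⟩ := boundedBy_dogPoint (a := a) (β := rowBits x d (2 + n * d)) hb hμ
  have hnd := mul_le_blockStart n d
  have hblock := four_mul_add_twenty_le_blockStart (d := d) hpos
  have hedges : edges n d = 4 * blockStart d n := rfl
  have hsize := val_sizeExpr (w := w) (i := i) hn hd hpos (by omega)
  have hlit {c : ℕ} (hc : OfNat.ofNat c ≤ 12) : (OfNat.ofNat c : Expr).val w x i = OfNat.ofNat c :=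
    val_ofNat (by omega)
  have hlevel := val_dogQuarterExpr hn hd hk (by omega)
  have hlevel_le := dogQuarter_le_twenty (d := d) (β := rowBits x d (2 + n * d)) μ
  have hsign : (dogPoint a b hb n d (rowBits x d (2 + n * d)) μ).y < 0 :=
    neg_neg_of_pos (Int.natCast_pos.2 (Nat.mul_pos ha μ.succ_pos))
  refine val_pointExpr (by omega) he hη (hlit (by norm_num)) ?_ ?_ ?_ ?_
  · exact val_mul (val_mul (val_mul (val_lit (by omega)) (hlit (by norm_num)) (by omega)) hsize
      (by rw [mul_right_comm]; omega)) (val_add hlevel (hlit le_rfl) (by omega))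
      (hX.trans_lt (by omega))
  · rw [if_pos hsign]
    exact hlit (by norm_num)
  · have hY' : (dogPoint a b hb n d (rowBits x d (2 + n * d)) μ).y.natAbs = a * (μ + 1) :=
      (Int.natAbs_neg _).trans (Int.natAbs_natCast _)
    rw [hY'] at hY ⊢
    exact val_mul (val_lit (by omega)) (val_add hk (hlit (by norm_num)) (by omega))
      (hY.trans_lt (by omega))
  · exact val_mul (val_mul (val_lit (by omega)) (hlit (by norm_num)) (by omega)) hsize
      (hden.trans_lt (by omega))

end Points

end BarkingReduction

/-! ### The reduction of decision problems -/

namespace BarkingReduction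

open WordRAM Expr

section Lists

variable {σ : Type*} {n m : ℕ} {f : Fin n → List σ}

theorem length_flatten_ofFn (hf : ∀ i, (f i).length = m) :
    (List.ofFn f).flatten.length = n * m := by
  simp only [List.length_flatten, List.map_ofFn, List.sum_ofFn, Function.comp_apply, hf,
    Finset.sum_const, Finset.card_univ, Fintype.card_fin, smul_eq_mul]

theorem getD_flatten_ofFn (hf : ∀ i, (f i).length = m) {c : ℕ} (hc : c < m) (i : Fin n) (z : σ) :
    (List.ofFn f).flatten.getD (i * m + c) z = (f i).getD c z := by
  induction n with
  | zero => exact i.elim0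
  | succ n ih =>
    rw [List.ofFn_succ, List.flatten_cons]
    refine Fin.cases ?_ (fun j => ?_) i
    · rw [Fin.val_zero, zero_mul, zero_add, List.getD_append _ _ _ _ (hc.trans_eq (hf 0).symm)]
    · have hj : (j.succ : ℕ) * m + c = m + (j * m + c) := by rw [Fin.val_succ]; ring
      rw [hj, List.getD_append_right _ _ _ _ ((hf 0).trans_le (Nat.le_add_right _ _)), hf,
        Nat.add_sub_cancel_left, ih (fun j => hf j.succ)]

end Lists

section OrthogonalVectors

variable {D : ℕ → ℕ} (I : OVInstance D)

theorem length_bitWords {n d : ℕ} (A : Fin n → Fin d → Bool) : (bitWords A).length = n * d :=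
  length_flatten_ofFn fun _ => List.length_ofFn

theorem getD_bitWords {n d : ℕ} (A : Fin n → Fin d → Bool) (i : Fin n) (c : Fin d) :
    (bitWords A).getD (i * d + c) 0 = (A i c).toNat := by
  rw [bitWords, getD_flatten_ofFn (fun _ => List.length_ofFn) c.2,
    List.getD_eq_getElem _ _ (by rw [List.length_ofFn]; exact c.2), List.getElem_ofFn]

theorem mul_add_lt_mul {n d : ℕ} (i : Fin n) (c : Fin d) : (i * d + c : ℕ) < n * d :=
  calc (i * d + c : ℕ) < i * d + d := Nat.add_lt_add_left c.2 _
    _ = (i + 1) * d := (Nat.succ_mul _ _).symm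
    _ ≤ n * d := Nat.mul_le_mul_right d i.2

theorem length_words_orthogonalVectors :
    ((orthogonalVectors D).words I).length = 2 * (I.n * D I.n) + 2 := by
  change (I.n :: D I.n :: (bitWords I.A ++ bitWords I.B)).length = _
  rw [List.length_cons, List.length_cons, List.length_append, length_bitWords, length_bitWords,
    two_mul]

/-- The first family of vectors, as read from the input. -/
def firstRows : ℕ → ℕ → Bool := rowBits (((orthogonalVectors D).words I).getD · 0) (D I.n) 2

/-- The second family of vectors, as read from the input. -/
def secondRows : ℕ → ℕ → Bool :=
  rowBits (((orthogonalVectors D).words I).getD · 0) (D I.n) (2 + I.n * D I.n)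

theorem firstRows_apply (i : Fin I.n) (c : Fin (D I.n)) : firstRows I i c = I.A i c := by
  have h : ((orthogonalVectors D).words I).getD (2 + (i * D I.n + c)) 0 = (I.A i c).toNat := by
    change (I.n :: D I.n :: (bitWords I.A ++ bitWords I.B)).getD _ 0 = _
    rw [add_comm 2, List.getD_cons_succ, List.getD_cons_succ,
      List.getD_append _ _ _ _ ((mul_add_lt_mul i c).trans_eq (length_bitWords _).symm),
      getD_bitWords]
  rw [firstRows, rowBits, h]
  cases I.A i c <;> rfl

theorem secondRows_apply (i : Fin I.n) (c : Fin (D I.n)) : secondRows I i c = I.B i c := by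
  have h : ((orthogonalVectors D).words I).getD (2 + I.n * D I.n + (i * D I.n + c)) 0 =
      (I.B i c).toNat := by
    change (I.n :: D I.n :: (bitWords I.A ++ bitWords I.B)).getD _ 0 = _
    rw [add_assoc, add_comm 2, List.getD_cons_succ, List.getD_cons_succ,
      List.getD_append_right _ _ _ _ ((length_bitWords _).trans_le (Nat.le_add_right _ _)),
      length_bitWords, Nat.add_sub_cancel_left, getD_bitWords]
  rw [secondRows, rowBits, h]
  cases I.B i c <;> rfl

theorem hasOrthogonalPair_rows_iff :
    HasOrthogonalPair I.n (D I.n) (firstRows I) (secondRows I) ↔ (orthogonalVectors D).Yes I := by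
  have horth (i j : Fin I.n) : Orthogonal (D I.n) (firstRows I i) (secondRows I j) ↔
      ∑ c, (I.A i c).toNat * (I.B j c).toNat = 0 := by
    simp only [Orthogonal, Finset.sum_eq_zero_iff, Finset.mem_univ, true_imp_iff, mul_eq_zero,
      Bool.toNat_eq_zero, ← firstRows_apply, ← secondRows_apply]
    exact ⟨fun h c => h c c.2, fun h c hc => h ⟨c, hc⟩⟩
  constructor
  · rintro ⟨i, hi, j, hj, h⟩
    exact ⟨⟨i, hi⟩, ⟨j, hj⟩, (horth ⟨i, hi⟩ ⟨j, hj⟩).1 h⟩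
  · rintro ⟨i, j, h⟩
    exact ⟨i, i.2, j, j.2, (horth i j).2 h⟩

end OrthogonalVectors

section BarkingWords

variable {κ : ℕ} (I : BarkingInstance κ) (ρ : ℝ)

theorem length_words_barkingDecision :
    ((barkingDecision ρ κ).words I).length = 10 * I.n + 1 := by
  change (I.n :: (_ ++ _)).length = _
  rw [List.length_cons, List.length_append, length_flatten_ofFn (m := 5) fun _ => rfl,
    length_flatten_ofFn (m := 5) fun _ => rfl]
  ring

theorem getD_words_barkingDecision_left (i : Fin I.n) {e : ℕ} (he : e < 5) :
    ((barkingDecision ρ κ).words I).getD (i * 5 + e + 1) 0 = (I.P i).words.getD e 0 := by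
  change (I.n :: (_ ++ _)).getD _ 0 = _
  rw [List.getD_cons_succ, List.getD_append _ _ _ _ (by
    rw [length_flatten_ofFn (m := 5) fun _ => rfl]
    omega), getD_flatten_ofFn (m := 5) (fun _ => rfl) he]

theorem getD_words_barkingDecision_right (i : Fin I.n) {e : ℕ} (he : e < 5) :
    ((barkingDecision ρ κ).words I).getD ((I.n + i) * 5 + e + 1) 0 = (I.Q i).words.getD e 0 := by
  change (I.n :: (_ ++ _)).getD _ 0 = _
  have hlen : (List.ofFn fun i => (I.P i).words).flatten.length = I.n * 5 :=
    length_flatten_ofFn fun _ => rfl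
  rw [List.getD_cons_succ, List.getD_append_right _ _ _ _ (by rw [hlen]; omega), hlen,
    show (I.n + i) * 5 + e - I.n * 5 = i * 5 + e by omega,
    getD_flatten_ofFn (m := 5) (fun _ => rfl) he]

end BarkingWords

section Instance

variable {a b κ n d : ℕ} (ha : 0 < a) (hb : 0 < b) (hκ : 100 * (a + b) ≤ 2 ^ κ) (hn : 1 ≤ n)
  (α β : ℕ → ℕ → Bool)

theorem boundedBy_pow_succ {P : RatPoint} {N : ℕ} (hP : P.BoundedBy (100 * ((a + b) * N)))
    (hκ : 100 * (a + b) ≤ 2 ^ κ) (hN : 2 ≤ N) : P.BoundedBy (N ^ (κ + 1)) := by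
  have h : 100 * ((a + b) * N) ≤ N ^ (κ + 1) :=
    calc 100 * ((a + b) * N) = 100 * (a + b) * N := (mul_assoc _ _ _).symm
      _ ≤ N ^ κ * N := Nat.mul_le_mul_right N (hκ.trans (Nat.pow_le_pow_left hN κ))
      _ = N ^ (κ + 1) := (pow_succ N κ).symm
  exact ⟨hP.1.trans h, hP.2.1.trans h, hP.2.2.trans h⟩

/-- The barking instance for two families of `n` vectors, in the horizontal unit `a / b`. -/
noncomputable def barkingInstance : BarkingInstance (κ + 1) :=
  have two_le : 2 ≤ edges n d + 1 := by
    have := four_mul_add_twenty_le_blockStart (d := d) hn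
    unfold edges
    omega
  have scale_pos : (0 : ℝ) < a / b := div_pos (Nat.cast_pos.2 ha) (Nat.cast_pos.2 hb)
  have hiker_step := dist_hikerLine_step scale_pos
    (unitSteps_hikerLevel (n := n) (d := d) (α := α)).dist_eq_one
  have dog_step := dist_dogLine_step scale_pos (unitSteps_dogLevel (d := d) (β := β)).dist_eq_one
  have rise_pos := rise_pos (n := n) (d := d) scale_pos
  { n := edges n d + 1
    two_le := two_le
    P := fun k => hikerPoint a b hb n d α k
    Q := fun i => dogPoint a b hb n d β i
    bounded_P := fun k =>
      boundedBy_pow_succ (boundedBy_hikerPoint hb (Nat.lt_succ_iff.1 k.2)) hκ two_le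
    bounded_Q := fun i =>
      boundedBy_pow_succ (boundedBy_dogPoint hb (Nat.lt_succ_iff.1 i.2)) hκ two_le
    simple_P := by
      rw [ratPolyline_hikerPoint hb]
      exact isSimple_slopedPolyline hiker_step rise_pos.ne'
    simple_Q := by
      rw [ratPolyline_dogPoint hb]
      exact isSimple_slopedPolyline dog_step (by linarith)
    disjoint := by
      rw [ratPolyline_hikerPoint hb, ratPolyline_dogPoint hb]
      exact disjoint_carrier_slopedPolyline hiker_step dog_step rise_pos (by linarith) }

theorem yes_barkingInstance_iff {ρ : ℝ} (hd : 2 ≤ d) (h₁ : 13 / 4 * ((a : ℝ) / b) ≤ ρ)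
    (h₂ : ρ < 7 / 2 * ((a : ℝ) / b)) :
    (barkingDecision ρ (κ + 1)).Yes (barkingInstance (d := d) ha hb hκ hn α β) ↔
      HasOrthogonalPair n d α β := by
  have hu : (0 : ℝ) < a / b := div_pos (Nat.cast_pos.2 ha) (Nat.cast_pos.2 hb)
  change Polyline.barkingDistance ρ 1
    (ratPolyline fun k : Fin (edges n d + 1) => hikerPoint a b hb n d α k)
    (ratPolyline fun i : Fin (edges n d + 1) => dogPoint a b hb n d β i) = 0 ↔ _
  rw [ratPolyline_hikerPoint, ratPolyline_dogPoint]
  exact ⟨hasOrthogonalPair_of_barkingDistance_eq_zero hd hn hu (rise_pos hu) h₂,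
    barkingDistance_eq_zero_of_hasOrthogonalPair hn hu h₁⟩

end Instance

/-- The expression for the number of words of the barking instance. -/
def lengthExpr : Expr := 10 * sizeExpr + 1

/-- The expression for word `index` of the barking instance. -/
def entryExpr (a b : ℕ) : Expr :=
  let vertex := (index - 1) / 5
  let word := (index - 1) % 5
  ifEq index 0 sizeExpr <| ifLt vertex sizeExpr (hikerPointExpr a b vertex word)
    (dogPointExpr a b (vertex - sizeExpr) word)

section Entries

variable {w n d a b κ i : ℕ} {x : ℕ → ℕ}

theorem val_lengthExpr (hn : x 0 = n) (hd : x 1 = d) (hpos : 1 ≤ n)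
    (hw : 10 * (edges n d + 1) + 1 < 2 ^ w) : lengthExpr.val w x i = 10 * (edges n d + 1) + 1 := by
  have hten : (10 : Expr).val w x i = 10 := val_ofNat (by omega)
  have hone : (1 : Expr).val w x i = 1 := val_ofNat (by omega)
  exact val_add (val_mul hten (val_sizeExpr hn hd hpos (by omega)) (by omega)) hone hw

theorem val_entryExpr (hn : x 0 = n) (hd : x 1 = d) (hpos : 1 ≤ n) (ha : 0 < a) (hb : 0 < b)
    (hκ : 100 * (a + b) ≤ 2 ^ κ) (hw : 100 * ((a + b + 1) * (edges n d + 1)) < 2 ^ w)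
    (hi : i < 10 * (edges n d + 1) + 1) (ρ : ℝ) :
    (entryExpr a b).val w x i = ((barkingDecision ρ (κ + 1)).words (barkingInstance (d := d) ha hb
      hκ hpos (rowBits x d 2) (rowBits x d (2 + n * d)))).getD i 0 := by
  have hN : edges n d + 1 ≤ (a + b + 1) * (edges n d + 1) := Nat.le_mul_of_pos_left _ (by omega)
  have hindex : index.val w x i = i := rfl
  have hlit {c : ℕ} (hc : OfNat.ofNat c ≤ 5) : (OfNat.ofNat c : Expr).val w x i = OfNat.ofNat c :=
    val_ofNat (by omega)
  have hsize := val_sizeExpr (w := w) (i := i) hn hd hpos (by omega)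
  rcases i.eq_zero_or_pos with rfl | hi0
  · exact val_ifEq hindex (hlit (by norm_num)) (fun _ => hsize) (q := 0) fun h => absurd rfl h
  obtain ⟨v, η, hη, rfl⟩ : ∃ v η, η < 5 ∧ i = v * 5 + η + 1 :=
    ⟨(i - 1) / 5, (i - 1) % 5, Nat.mod_lt _ (by norm_num), by omega⟩
  have hpred : (index - 1).val w x (v * 5 + η + 1) = v * 5 + η :=
    val_sub hindex (hlit (by norm_num)) hi0 (by omega)
  have hvertex := (val_div hpred (hlit le_rfl)).trans (show (v * 5 + η) / 5 = v by omega)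
  have hword := (val_mod hpred (hlit le_rfl)).trans (show (v * 5 + η) % 5 = η by omega)
  refine (val_ifEq hindex (hlit (by norm_num)) (fun _ => hsize) fun _ =>
    val_ifLt hvertex hsize
      (fun h => val_hikerPointExpr hn hd hpos hb hvertex (by omega) hword hη hw)
      (fun h => val_dogPointExpr hn hd hpos ha hb (val_sub hvertex hsize h (by omega)) (by omega)
        hword hη hw)).trans ?_
  rw [if_neg hi0.ne']
  split_ifs with h
  · exact (getD_words_barkingDecision_left (barkingInstance ha hb hκ hpos _ _) ρ ⟨v, h⟩ hη).symm
  · obtain ⟨j, rfl⟩ := Nat.exists_eq_add_of_le (not_lt.1 h)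
    rw [Nat.add_sub_cancel_left]
    exact (getD_words_barkingDecision_right (barkingInstance ha hb hκ hpos _ _) ρ
      ⟨j, by change j < edges n d + 1; omega⟩ hη).symm

theorem edges_le (n : ℕ) (hd : 2 ≤ d) : edges n d ≤ 56 * (n * d) := by
  have h := Nat.mul_le_mul_left n hd
  calc edges n d = 16 * (n * d) + 40 * (n * 2) := by unfold edges blockStart; ring
    _ ≤ 56 * (n * d) := by omega

theorem hundred_mul_edges_lt_pow (hd : 2 ≤ d) (a b : ℕ) :
    100 * ((a + b + 1) * (edges n d + 1)) <
      (2 * (n * d) + 4) ^ (2800 * (a + b + 1) + 1) := by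
  have := edges_le n hd
  have hN : edges n d + 1 ≤ 28 * (2 * (n * d) + 4) := by omega
  calc 100 * ((a + b + 1) * (edges n d + 1))
      ≤ 100 * ((a + b + 1) * (28 * (2 * (n * d) + 4))) := by gcongr
    _ = 2800 * (a + b + 1) * (2 * (n * d) + 4) := by ring
    _ < (2 * (n * d) + 4) ^ (2800 * (a + b + 1)) * (2 * (n * d) + 4) :=
        Nat.mul_lt_mul_of_pos_right (Nat.lt_pow_self (by omega)) (by omega)
    _ = (2 * (n * d) + 4) ^ (2800 * (a + b + 1) + 1) := (pow_succ _ _).symm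

theorem describes_barkingInstance (ha : 0 < a) (hb : 0 < b) (hκ : 100 * (a + b) ≤ 2 ^ κ) (ρ : ℝ)
    {D : ℕ → ℕ} (I : OVInstance D)
    (hw : 100 * ((a + b + 1) * (edges I.n (D I.n) + 1)) < 2 ^ w) :
    Describes w lengthExpr (entryExpr a b) ((orthogonalVectors D).words I)
      ((barkingDecision ρ (κ + 1)).words
        (barkingInstance (d := D I.n) ha hb hκ I.one_le (firstRows I) (secondRows I))) := by
  set x : ℕ → ℕ := (((orthogonalVectors D).words I).getD · 0)
  have hn : x 0 = I.n := rfl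
  have hd : x 1 = D I.n := rfl
  have hN : edges I.n (D I.n) + 1 ≤ (a + b + 1) * (edges I.n (D I.n) + 1) :=
    Nat.le_mul_of_pos_left _ (by omega)
  have hlen : ((barkingDecision ρ (κ + 1)).words (barkingInstance (d := D I.n) ha hb hκ I.one_le
      (firstRows I) (secondRows I))).length = 10 * (edges I.n (D I.n) + 1) + 1 :=
    length_words_barkingDecision _ ρ
  refine ⟨by omega, (val_lengthExpr hn hd I.one_le (by omega)).trans hlen.symm, fun i hi => ?_⟩
  rw [hlen] at hi
  exact val_entryExpr hn hd I.one_le ha hb hκ hw hi ρ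

end Entries

section Reduction

variable {a b κ : ℕ} (ha : 0 < a) (hb : 0 < b) (hκ : 100 * (a + b) ≤ 2 ^ κ) {ρ : ℝ}
  (h₁ : 13 / 4 * ((a : ℝ) / b) ≤ ρ) (h₂ : ρ < 7 / 2 * ((a : ℝ) / b)) {D : ℕ → ℕ}
  (hD : ∀ n, 2 ≤ D n)

/-- The reduction from orthogonal vectors, for a scale `a / b` adapted to the barking radius. -/
noncomputable def barkingReduction :
    Reduction (orthogonalVectors D) (barkingDecision ρ (κ + 1)) where
  map (I : OVInstance D) :=
    barkingInstance (d := D I.n) ha hb hκ I.one_le (firstRows I) (secondRows I)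
  yes_map (I : OVInstance D) := (yes_barkingInstance_iff ha hb hκ I.one_le _ _ (hD _) h₁ h₂).trans
    (hasOrthogonalPair_rows_iff I)
  length := lengthExpr
  entry := entryExpr a b
  k := 2800 * (a + b + 1) + 1
  length_words_map (I : OVInstance D) := by
    have := hundred_mul_edges_lt_pow (n := I.n) (hD I.n) a b
    have hN : edges I.n (D I.n) + 1 ≤ (a + b + 1) * (edges I.n (D I.n) + 1) :=
      Nat.le_mul_of_pos_left _ (by omega)
    rw [length_words_barkingDecision, length_words_orthogonalVectors I]
    change 10 * (edges I.n (D I.n) + 1) + 1 + 2 ≤ (2 * (I.n * D I.n) + 4) ^ _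
    omega
  describes (I : OVInstance D) w hw := by
    rw [length_words_orthogonalVectors I] at hw
    exact describes_barkingInstance ha hb hκ ρ I
      ((hundred_mul_edges_lt_pow (hD I.n) a b).trans_le hw)

theorem size_barkingReduction (I : OVInstance D) :
    (barkingDecision ρ (κ + 1)).size ((barkingReduction ha hb hκ h₁ h₂ hD).map I) =
      edges I.n (D I.n) + 1 :=
  rfl

theorem length_words_barkingReduction (I : OVInstance D) :
    ((barkingDecision ρ (κ + 1)).words ((barkingReduction ha hb hκ h₁ h₂ hD).map I)).length =
      10 * (edges I.n (D I.n) + 1) + 1 :=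
  length_words_barkingDecision _ ρ

end Reduction

theorem exists_scale {ρ : ℝ} (hρ : 0 < ρ) : ∃ a b : ℕ, 0 < a ∧ 0 < b ∧
    13 / 4 * ((a : ℝ) / b) ≤ ρ ∧ ρ < 7 / 2 * ((a : ℝ) / b) := by
  obtain ⟨q, h₁, h₂⟩ := exists_rat_btwn (show ρ / (7 / 2) < ρ / (13 / 4) by
    rw [div_lt_div_iff₀ (by norm_num) (by norm_num)]
    linarith)
  have hq : 0 < q := by exact_mod_cast (by positivity : 0 < ρ / (7 / 2)).trans h₁
  lift q to ℚ≥0 using hq.le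
  rw [lt_div_iff₀ (by norm_num)] at h₂
  rw [div_lt_iff₀ (by norm_num)] at h₁
  have hcast : ((q : ℚ) : ℝ) = q.num / q.den := by rw [← NNRat.cast_def, Rat.cast_nnratCast]
  refine ⟨q.num, q.den, NNRat.num_pos.2 (by exact_mod_cast hq), q.den_pos, ?_, ?_⟩ <;>
    rw [← hcast] <;> linarith

/-- The dimension of the orthogonal vectors instances: superlogarithmic, yet at most a small power
of the number of vectors. -/
noncomputable def dimension (δ : ℝ) (n : ℕ) : ℕ := ⌈(n : ℝ) ^ δ⌉₊ + 2

theorem two_le_dimension (δ : ℝ) (n : ℕ) : 2 ≤ dimension δ n := Nat.le_add_left 2 _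

section Dimension

variable {δ : ℝ} (hδ : 0 < δ) {n : ℕ} (hn : 1 ≤ n)
include hδ

theorem isLittleO_log_dimension :
    (fun n : ℕ => Real.log n) =o[Filter.atTop] fun n : ℕ => (dimension δ n : ℝ) := by
  refine ((isLittleO_log_rpow_atTop hδ).comp_tendsto tendsto_natCast_atTop_atTop).trans_le
    fun n => ?_
  rw [Function.comp_apply, Real.norm_of_nonneg (by positivity), Real.norm_of_nonneg (by positivity),
    dimension, Nat.cast_add]
  exact (Nat.le_ceil _).trans (le_add_of_nonneg_right (Nat.cast_nonneg 2))

include hn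

theorem dimension_le : (dimension δ n : ℝ) ≤ 4 * (n : ℝ) ^ δ := by
  have hceil := (Nat.ceil_lt_add_one (by positivity : 0 ≤ (n : ℝ) ^ δ)).le
  have hone := Real.one_le_rpow (Nat.one_le_cast.2 hn) hδ.le
  rw [dimension, Nat.cast_add, Nat.cast_ofNat]
  linarith

theorem edges_dimension_add_one_le :
    ((edges n (dimension δ n) + 1 : ℕ) : ℝ) ≤ 240 * (n : ℝ) ^ (1 + δ) := by
  have hone := Real.one_le_rpow (Nat.one_le_cast.2 hn) (by positivity : 0 ≤ 1 + δ)
  calc ((edges n (dimension δ n) + 1 : ℕ) : ℝ)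
      ≤ ((56 * (n * dimension δ n) + 1 : ℕ) : ℝ) :=
        Nat.cast_le.2 (Nat.add_le_add_right (edges_le n (two_le_dimension δ n)) 1)
    _ = 56 * (n * dimension δ n) + 1 := by push_cast; rfl
    _ ≤ 56 * (n * (4 * (n : ℝ) ^ δ)) + 1 := by
        have := dimension_le hδ hn
        gcongr
    _ = 224 * (n : ℝ) ^ (1 + δ) + 1 := by
        rw [Real.rpow_add (by positivity), Real.rpow_one]
        ring
    _ ≤ 240 * (n : ℝ) ^ (1 + δ) := by linarith

end Dimension

section Subquadratic

variable {x N c ε : ℝ} (hx : 1 ≤ x) (hε₁ : ε ≤ 1)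
include hx hε₁

theorem le_rpow_two_sub (hc : 0 ≤ c) (hN : N ≤ c * x ^ (1 + ε / 8)) :
    N ≤ c * x ^ (2 - ε / 2) :=
  hN.trans (mul_le_mul_of_nonneg_left (Real.rpow_le_rpow_of_exponent_le hx (by linarith)) hc)

theorem rpow_le_rpow_two_sub {ε' : ℝ} (hε : 0 < ε) (hεε' : ε ≤ ε') (hc : 1 ≤ c) (hN₁ : 1 ≤ N)
    (hN : N ≤ c * x ^ (1 + ε / 8)) : N ^ (2 - ε') ≤ c ^ 2 * x ^ (2 - ε / 2) :=
  calc N ^ (2 - ε') ≤ N ^ (2 - ε) := Real.rpow_le_rpow_of_exponent_le hN₁ (by linarith)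
    _ ≤ (c * x ^ (1 + ε / 8)) ^ (2 - ε) :=
        Real.rpow_le_rpow (by positivity) hN (by linarith)
    _ = c ^ (2 - ε) * x ^ ((1 + ε / 8) * (2 - ε)) := by
        rw [Real.mul_rpow (by positivity) (by positivity), ← Real.rpow_mul (by positivity)]
    _ ≤ c ^ (2 : ℝ) * x ^ (2 - ε / 2) := by
        gcongr <;> nlinarith
    _ = c ^ 2 * x ^ (2 - ε / 2) := by rw [Real.rpow_two]

end Subquadratic

theorem solvableInTime_orthogonalVectors {a b κ : ℕ} (ha : 0 < a) (hb : 0 < b)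
    (hκ : 100 * (a + b) ≤ 2 ^ κ) {ρ : ℝ} (h₁ : 13 / 4 * ((a : ℝ) / b) ≤ ρ)
    (h₂ : ρ < 7 / 2 * ((a : ℝ) / b)) {ε ε' : ℝ} (hε : 0 < ε) (hε₁ : ε ≤ 1) (hεε' : ε ≤ ε')
    (h : (barkingDecision ρ (κ + 1)).SolvableInTime fun n => (n : ℝ) ^ (2 - ε')) :
    (orthogonalVectors (dimension (ε / 8))).SolvableInTime fun n => (n : ℝ) ^ (2 - ε / 2) := by
  have hδ : 0 < ε / 8 := by positivity
  refine h.of_reduction (K := 240 ^ 2) (barkingReduction ha hb hκ h₁ h₂ (two_le_dimension _))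
    (fun (I : OVInstance _) => ?_) (fun (I : OVInstance _) => ?_) <;>
    change _ ≤ 240 ^ 2 * (I.n : ℝ) ^ (2 - ε / 2)
  · have hN := le_rpow_two_sub (Nat.one_le_cast.2 I.one_le) hε₁ (by norm_num)
      (edges_dimension_add_one_le hδ I.one_le)
    rw [length_words_barkingReduction]
    push_cast at hN ⊢
    linarith
  · rw [size_barkingReduction, abs_of_nonneg (by positivity)]
    exact rpow_le_rpow_two_sub (Nat.one_le_cast.2 I.one_le) hε₁ hε hεε' (by norm_num)
      (Nat.one_le_cast.2 (Nat.le_add_left 1 _)) (edges_dimension_add_one_le hδ I.one_le)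

end BarkingReduction

open BarkingReduction in
theorem mainTheorem4 (hOVC : OrthogonalVectorsConjecture) (ρ : ℝ) (hρ : 0 < ρ) :
    ∃ κ : ℕ, ∀ ε : ℝ, 0 < ε →
      ¬ (barkingDecision ρ κ).SolvableInTime fun n => (n : ℝ) ^ (2 - ε) := by
  obtain ⟨a, b, ha, hb, h₁, h₂⟩ := exists_scale hρ
  have hκ : 100 * (a + b) ≤ 2 ^ (100 * (a + b)) := Nat.lt_two_pow_self.le
  refine ⟨100 * (a + b) + 1, fun ε hε hsolvable => ?_⟩
  have hε₁ : 0 < min ε 1 := lt_min hε one_pos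
  exact hOVC (dimension (min ε 1 / 8)) (isLittleO_log_dimension (by positivity)) (min ε 1 / 2)
    (by positivity) (solvableInTime_orthogonalVectors ha hb hκ h₁ h₂ hε₁ (min_le_right ε 1)
      (min_le_left ε 1) hsolvable)
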